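/- Let $T>0$, let $f:\mathbb{R}\to(0,\infty)$ be $C^1$, and put $F(y)=\int_0^y f(u)\,du$. Assume $F(y)\to\pm\infty$ as $y\to\pm\infty$, so that $F$ is a bijection of $\mathbb{R}$. Put $G(y)=\int_0^{F^{-1}(y)}u f(u)\,du$. Let $\lambda:[0,T]\to(0,\infty)$ be $C^2$, let $\rho:[0,T]\to(0,\infty)$ be $C^1$, put $\eta_t=\lambda'(t)/\lambda(t)$, and fix $\mathbf{x}\in\mathbb{R}$. An admissible path is a left-continuous function $X$ of bounded variation on $[0,T+]$ (that is, on $[0,T]$ with an additional terminal value $X_{T+}$ allowing a jump at time $T$) such that $X_0=\mathbf{x}$ and $X_{T+}=0$. Its jumps are $\Delta X_t=X_{t+}-X_t$, and $X^c_t=X_t-\sum_{0\le s<t}\Delta X_s$ is its continuous part. Its volume impact is the solution $E$ of $dE_t=dX_t-\rho_tE_t\,dt$, $E_0=0$, i.e. $E_t=X_t-\mathbf{x}-\int_0^t\rho_sE_s\,ds$. Its cost is $$C^V(X)=\int_0^T F^{-1}\!\left(\frac{E_t}{\lambda(t)}\right)dX^c_t+\sum_{0\le t\le T}\lambda(t)\left[G\!\left(\frac{E_t+\Delta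 X_t}{\lambda(t)}\right)-G\!\left(\frac{E_t}{\lambda(t)}\right)\right].$$ An admissible strategy on a filtered probability space is an adapted process whose paths are almost surely admissible paths, with total variation almost surely bounded by a constant. For $t\in[0,T]$ and $y\in\mathbb{R}$ let $$h_{V,t}(y)=F^{-1}(y)+\frac{\eta_t+\rho_t}{\rho_t}\,\frac{y}{f(F^{-1}(y))},$$ and assume that, for every $t\in[0,T]$, $h_{V,t}$ is a bijection of $\mathbb{R}$ with $h_{V,t}'>0$ everywhere. Then: 1. $C^V(X)$ is well defined (the integral and the sum converge absolutely) and $C^V(X)\ge 0$ for every admissible path $X$. 2. The equation $$\int_0^T\lambda(t)\rho_t\,h_{V,t}^{-1}(\nu)\,dt+\lambda(T)F(\nu)=-\mathbf{x}$$ has a unique solution $\nu\in\mathbb{R}$. 3. For this $\nu$, the function $\zeta_t=h_{V,t}^{-1}(\nu)$ is $C^1$ on $[0,T]$. Put $$\xi^\star_0=\lambda(0)\zeta_0,\qquad \xi^\star_t=\lambda(t)\left[\frac{d\zeta_t}{dt}+(\rho_t+\eta_t)\zeta_t\right],\qquad \xi^\star_T=\lambda(T)\,(F(\nu)-\zeta_T),$$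 where $\xi^\star_t$, a continuous function of $t\in[0,T]$, is the trading rate, while $\xi^\star_0$ and $\xi^\star_T$ are the initial and final jumps. The path $X^\star$ with $X^\star_0=\mathbf{x}$ and $dX^\star_t=\xi^\star_0\,\delta_0(dt)+\xi^\star_t\,dt+\xi^\star_T\,\delta_T(dt)$ is admissible and is the unique minimizer of $C^V$ among admissible paths. Moreover, on every filtered probability space and for every admissible strategy $X$ on it, $C^V(X)$ is integrable, $\mathbb{E}[C^V(X)]\ge C^V(X^\star)$, and equality holds only if $X=X^\star$ almost surely. 4. The initial trade $\xi^\star_0$ has the same sign as $-\mathbf{x}$ (and is $0$ if $\mathbf{x}=0$). -/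

import Mathlib

open MeasureTheory Set Filter Topology
open scoped NNReal ENNReal

noncomputable section

namespace OptimalExecution

/-! ### The limit order book -/

/-- The antiderivative `F` of the shape function `f`, normalised by `F 0 = 0`. -/
def shapeF (f : ℝ → ℝ) (x : ℝ) : ℝ := ∫ y in (0 : ℝ)..x, f y

/-- The inverse function `F⁻¹` of the bijection `F` of `ℝ`. -/
def shapeFInv (f : ℝ → ℝ) : ℝ → ℝ := Function.invFun (shapeF f)

/-- `F̃ x = ∫₀ˣ y f(y) dy`. -/
def shapeFTilde (f : ℝ → ℝ) (x : ℝ) : ℝ := ∫ y in (0 : ℝ)..x, y * f y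

/-- `G = F̃ ∘ F⁻¹`. -/
def shapeG (f : ℝ → ℝ) (x : ℝ) : ℝ := shapeFTilde f (shapeFInv f x)

/-- `η_t = λ'(t) / λ(t)`, for a depth function `λ` on `[0, T]`. -/
def eta (T : ℝ) (lam : ℝ → ℝ) (t : ℝ) : ℝ := derivWithin lam (Icc 0 T) t / lam t

/-- `h_{V,t}(x) = F⁻¹(x) + ((η_t + ρ_t) / ρ_t) * x / f(F⁻¹(x))`. -/
def hV (T : ℝ) (f lam rho : ℝ → ℝ) (t x : ℝ) : ℝ :=
  shapeFInv f x + (eta T lam t + rho t) / rho t * (x / f (shapeFInv f x))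

/-- The inverse function `h_{V,t}⁻¹`. -/
def hVInv (T : ℝ) (f lam rho : ℝ → ℝ) (t : ℝ) : ℝ → ℝ :=
  Function.invFun (hV T f lam rho t)

/-! ### Trading strategies -/

/-- A (path of a) trading strategy liquidating `x` shares on `[0, T]`: `X t` is the number of
shares still to be liquidated at time `t`.  A path on `[0, T+]` is represented by its canonical
extension to the line, constant equal to `x` up to time `0` and to `X_{T+} = 0` after time `T`, so
that the jump at `T` is `X_{T+} - X_T = -X_T`. -/
structure AdmissiblePath (T x : ℝ) (X : ℝ → ℝ) : Prop where
  initial : ∀ t, t ≤ 0 → X t = x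
  terminal : ∀ t, T < t → X t = 0
  leftContinuous : ∀ t, ContinuousWithinAt X (Iic t) t
  boundedVariation : BoundedVariationOn X univ

/-- An admissible (random) strategy on a filtered probability space: an adapted left-continuous
process that starts at `x`, ends at `X_{T+} = 0`, and whose total variation is almost surely bounded
by a constant. -/
structure AdmissibleStrategy {Ω : Type*} [mΩ : MeasurableSpace Ω] (P : Measure Ω)
    (ℱ : Filtration ℝ≥0 mΩ) (T x : ℝ) (X : ℝ → Ω → ℝ) : Prop where
  adapted : ∀ t : ℝ≥0, (t : ℝ) ≤ T → Measurable[ℱ t] (X t)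
  path : ∀ᵐ ω ∂P, AdmissiblePath T x (fun t => X t ω)
  bounded : ∃ M : ℝ≥0, ∀ᵐ ω ∂P, eVariationOn (fun t => X t ω) univ ≤ (M : ℝ≥0∞)

/-- The jump `ΔX_t = X_{t+} - X_t`. -/
def jump (X : ℝ → ℝ) (t : ℝ) : ℝ := Function.rightLim X t - X t

open scoped Classical in
/-- The signed (Stieltjes) measure `dX` of a path `X` of bounded variation. -/
def pathMeasure (X : ℝ → ℝ) : SignedMeasure ℝ :=
  if hX : BoundedVariationOn X univ then hX.vectorMeasure else 0

/-- The volume impact process `E` of model `V`, i.e. the solution of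
`dE_t = dX_t - ρ_t E_t dt`, `E_0 = 0`, written by variation of constants and an integration by
parts (see `volumeImpact_eq`). -/
def volumeImpact (rho X : ℝ → ℝ) (t : ℝ) : ℝ :=
  (X t - X 0) -
    ∫ s in (0 : ℝ)..t, rho s * Real.exp (-∫ u in s..t, rho u) * (X s - X 0)

theorem volumeImpact_eq_aux {rho X : ℝ → ℝ} (hrho : Continuous rho)
    (hX : BoundedVariationOn X univ) {t : ℝ} (ht : 0 ≤ t) :
    volumeImpact rho X t = X t - X 0 - ∫ s in (0 : ℝ)..t, rho s * volumeImpact rho X s := by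
  obtain ⟨p, q, hp, hq, hpq⟩ := hX.locallyBoundedVariationOn.exists_monotoneOn_sub_monotoneOn
  rw [monotoneOn_univ] at hp hq
  set R : ℝ → ℝ := fun t => ∫ u in (0 : ℝ)..t, rho u with hR
  have hRd : ∀ t, HasDerivAt R (rho t) t := fun t => hrho.integral_hasStrictDerivAt 0 t |>.hasDerivAt
  have hRc : Continuous R := continuous_iff_continuousAt.2 fun t => (hRd t).continuousAt
  set Y : ℝ → ℝ := fun s => X s - X 0 with hY
  have hYi : ∀ a b, IntervalIntegrable Y volume a b := by
    intro a b
    have : Y = fun s => p s - q s - X 0 := by rw [hY, hpq]; rfl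
    rw [this]
    exact (hp.intervalIntegrable.sub hq.intervalIntegrable).sub intervalIntegrable_const
  set g : ℝ → ℝ := fun s => rho s * Real.exp (R s) * Y s with hg
  have hgi : ∀ a b, IntervalIntegrable g volume a b := fun a b =>
    (hYi a b).continuousOn_mul (by fun_prop)
  set u : ℝ → ℝ := fun t => Real.exp (-R t) * ∫ s in (0 : ℝ)..t, g s with hu
  have hv : ∀ t, volumeImpact rho X t = Y t - u t := by
    intro t
    simp only [volumeImpact, hY, hu, ← intervalIntegral.integral_const_mul]
    congr 1
    refine intervalIntegral.integral_congr fun s _ => ?_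
    have : ∫ v in s..t, rho v = R t - R s := by
      simp only [hR]
      rw [intervalIntegral.integral_interval_sub_left] <;> exact hrho.intervalIntegrable _ _
    simp only [hg, hY, this]
    rw [show -(R t - R s) = -R t + R s by ring, Real.exp_add]
    ring
  have huc : Continuous u := by
    have := intervalIntegral.continuous_primitive hgi 0
    exact (Real.continuous_exp.comp hRc.neg).mul this
  have hS : ({s | ¬ContinuousAt p s} ∪ {s | ¬ContinuousAt q s}).Countable :=
    hp.countable_not_continuousAt.union hq.countable_not_continuousAt
  have key := integral_eq_of_hasDerivAt_off_countable_of_le u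
    (fun s => rho s * (Y s - u s)) ht hS huc.continuousOn (by
      rintro s ⟨-, hs⟩
      simp only [mem_union, mem_ofPred_eq, not_or, not_not] at hs
      have hYc : ContinuousAt Y s := by
        have : Y = fun s => p s - q s - X 0 := by rw [hY, hpq]; rfl
        rw [this]
        exact (hs.1.sub hs.2).sub continuousAt_const
      have hgc : ContinuousAt g s :=
        (hrho.continuousAt.mul (Real.continuous_exp.comp hRc).continuousAt).mul hYc
      have hgm : StronglyMeasurableAtFilter g (𝓝 s) volume :=
        ⟨Ioo (s - 1) (s + 1), Ioo_mem_nhds (by linarith) (by linarith),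
          ((hgi (s - 1) (s + 1)).1.aestronglyMeasurable).mono_set Ioo_subset_Ioc_self⟩
      have h1 := intervalIntegral.integral_hasDerivAt_right (hgi 0 s) hgm hgc
      have h2 := ((hRd s).neg.exp).mul h1
      refine h2.congr_deriv ?_
      simp only [hu, hg, Pi.neg_apply]
      have : Real.exp (-R s) * Real.exp (R s) = 1 := by rw [← Real.exp_add]; simp
      linear_combination (rho s * Y s) * this)
    (((hYi 0 t).sub (huc.intervalIntegrable 0 t)).continuousOn_mul hrho.continuousOn)
  simp only [hv]
  rw [key]
  simp [hu, hY]

/-- `volumeImpact` solves `E_t = X_t - X_0 - ∫₀ᵗ ρ_s E_s ds` on `[0, T]`. -/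
theorem volumeImpact_eq {T : ℝ} {rho X : ℝ → ℝ} (hrho : ContinuousOn rho (Icc 0 T))
    (hX : BoundedVariationOn X univ) {t : ℝ} (ht : t ∈ Icc 0 T) :
    volumeImpact rho X t = X t - X 0 - ∫ s in (0 : ℝ)..t, rho s * volumeImpact rho X s := by
  have hT : 0 ≤ T := ht.1.trans ht.2
  set r : ℝ → ℝ := IccExtend hT ((Icc 0 T).domRestrict rho) with hr
  have hrc : Continuous r := (continuousOn_iff_continuous_domRestrict.1 hrho).Icc_extend'
  have hreq : ∀ s ∈ Icc 0 T, r s = rho s := fun s hs => by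
    rw [hr, IccExtend_of_mem _ _ hs]; rfl
  have hv : ∀ s ∈ Icc 0 T, volumeImpact rho X s = volumeImpact r X s := by
    intro s hs
    unfold volumeImpact
    congr 1
    refine intervalIntegral.integral_congr fun v hv => ?_
    rw [uIcc_of_le hs.1] at hv
    have h1 : ∫ u in v..s, r u = ∫ u in v..s, rho u := by
      refine intervalIntegral.integral_congr fun w hw => ?_
      rw [uIcc_of_le hv.2] at hw
      exact hreq w ⟨hv.1.trans hw.1, hw.2.trans hs.2⟩
    simp only [h1, hreq v ⟨hv.1, hv.2.trans hs.2⟩]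
  rw [hv t ht, volumeImpact_eq_aux hrc hX ht.1]
  congr 1
  refine intervalIntegral.integral_congr fun s hs => ?_
  rw [uIcc_of_le ht.1] at hs
  have hs' : s ∈ Icc 0 T := ⟨hs.1, hs.2.trans ht.2⟩
  simp only [hreq s hs', hv s hs']

/-- The integrand `F⁻¹(E_t / λ(t))`, i.e. the price impact `D_t`. -/
def priceImpact (f lam rho X : ℝ → ℝ) (t : ℝ) : ℝ :=
  shapeFInv f (volumeImpact rho X t / lam t)

/-- The cost `λ(t) [G((E_t + ΔX_t) / λ(t)) - G(E_t / λ(t))]` of the jump of `X` at time `t`. -/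
def jumpCost (f lam rho X : ℝ → ℝ) (t : ℝ) : ℝ :=
  lam t * (shapeG f ((volumeImpact rho X t + jump X t) / lam t) -
    shapeG f (volumeImpact rho X t / lam t))

/-- The times of `[0, T]` at which `X` is continuous. -/
def continuityTimes (T : ℝ) (X : ℝ → ℝ) : Set ℝ := {t | t ∈ Icc 0 T ∧ ContinuousAt X t}

/-- The cost `C^V(X)` of a path `X` in model `V`,
`∫_{[0,T]} F⁻¹(E_t / λ(t)) dX^c_t + ∑_{t ≤ T} λ(t) [G((E_t + ΔX_t) / λ(t)) - G(E_t / λ(t))]`.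
The measure `dX^c` of the continuous part of `X` is the restriction of `dX` to the set of times at
which `X` is continuous, since the other times are countably many and carry the jumps. -/
def costV (T : ℝ) (f lam rho X : ℝ → ℝ) : ℝ :=
  (∫ᵛ t in continuityTimes T X, priceImpact f lam rho X t ∂•(pathMeasure X)) +
    ∑' t : Icc (0 : ℝ) T, jumpCost f lam rho X t

/-- The path with `dX_t = ξ₀ δ₀(dt) + ξ_t dt + ξ_T δ_T(dt)` on `[0, T]` and `X_0 = x`. -/
def tradePath (T x xi₀ : ℝ) (xi : ℝ → ℝ) (xi_T : ℝ) (t : ℝ) : ℝ :=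
  x + (if 0 < t then xi₀ else 0) + (∫ s in (0 : ℝ)..(max 0 (min t T)), xi s) +
    (if T < t then xi_T else 0)

/-- The equation for `ν`: `∫₀ᵀ λ(t) ρ_t h_{V,t}⁻¹(ν) dt + λ(T) F(ν) = -x`. -/
def MultiplierEq (T x : ℝ) (f lam rho : ℝ → ℝ) (nu : ℝ) : Prop :=
  (∫ t in (0 : ℝ)..T, lam t * rho t * hVInv T f lam rho t nu) + lam T * shapeF f nu = -x

/-- `ζ_t = h_{V,t}⁻¹(ν)`. -/
def zeta (T : ℝ) (f lam rho : ℝ → ℝ) (nu t : ℝ) : ℝ := hVInv T f lam rho t nu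

/-- The initial trade `ξ*_0 = λ(0) ζ_0`. -/
def initialTrade (T : ℝ) (f lam rho : ℝ → ℝ) (nu : ℝ) : ℝ :=
  lam 0 * zeta T f lam rho nu 0

/-- The trading rate `ξ*_t = λ(t) [dζ_t/dt + (ρ_t + η_t) ζ_t]`. -/
def tradingRate (T : ℝ) (f lam rho : ℝ → ℝ) (nu t : ℝ) : ℝ :=
  lam t * (derivWithin (zeta T f lam rho nu) (Icc 0 T) t +
    (rho t + eta T lam t) * zeta T f lam rho nu t)

/-- The final trade `ξ*_T = λ(T) (F(ν) - ζ_T)`. -/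
def finalTrade (T : ℝ) (f lam rho : ℝ → ℝ) (nu : ℝ) : ℝ :=
  lam T * (shapeF f nu - zeta T f lam rho nu T)

/-- The strategy `X*` with `dX*_t = ξ*_0 δ₀(dt) + ξ*_t dt + ξ*_T δ_T(dt)`. -/
def optimalPath (T x : ℝ) (f lam rho : ℝ → ℝ) (nu : ℝ) : ℝ → ℝ :=
  tradePath T x (initialTrade T f lam rho nu) (tradingRate T f lam rho nu)
    (finalTrade T f lam rho nu)

end OptimalExecution

end

/-! The cost depends on `X` only through its volume impact `E`, and as a convex functional of `E`.
Let `Φ(t, e) = λ(t) G(e / λ(t))`, the cost of building up the impact `e` by one block trade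
(`blockCost`). Since `G' = F⁻¹`, the partial derivative of `Φ` in `e` is the price impact, and the
cost of a jump is the increment of `Φ(t, ·)` across it. The chain rule for `Φ(t, E_t)` with `dE = dX
- ρ E dt` (`chain_rule`) therefore turns the cost into boundary terms and a `dt`-integral. With
`E_{T+} = -x - ∫ ρ E` and `a_t = (η_t + ρ_t) / ρ_t` this reads (`costV_spec`) `C^V(X) = λ(T) G((-x -
∫ ρ E) / λ(T)) + ∫ λ ρ H_t(E_t / λ(t)) dt`, `H_t = hPrim f a_t`, `H_t' = h_{V,t}`.

Both `F⁻¹` and `h_{V,t}` are strictly increasing and vanish at `0`, so `G` and `H_t` are strictly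
convex with minimum value `0`; hence the cost is nonnegative. For optimality, take tangents of `H_t`
at `ζ_t` and of `G` at `F(ν)`. All of them have slope `ν`, and the equation for `ν` says exactly
that the impact `E = λ ζ` leads to the terminal value `E_{T+} = λ(T) F(ν)`. The linear terms cancel,
and the excess cost of any `E` over `λ ζ` is a sum of two nonnegative convexity gaps
(`reducedCost_sub_eq`). If it vanishes, then `E = λ ζ` almost everywhere, hence on all of `(0, T]`
by left-continuity, and `X = x + E + ∫ ρ E` is determined. Reading that formula backwards produces
`X*`.

The chain rule is proved without separating `X` into a continuous and a jump part: one integrand,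
`jumpSlope`, is integrated against all of `dX`. The defect of the formula has increments that are
locally at most `ε` times those of a fixed increasing function, so it is constant
(`eq_of_local_increment_bound`).

The equation for `ν` is solved by monotonicity and growth, and `ζ` is `C¹` by the inverse function
theorem. For random strategies the inequality holds path by path; what remains is measurability of
the cost in `ω`, and its boundedness, which comes from the uniform bound on the total variation. -/

namespace OptimalExecution

noncomputable section

/-! ### Auxiliary facts about real functions -/

/-- A function whose increments are, on both sides of every point, locally bounded by arbitrarily
small multiples of the increments of a fixed function has the same values at both endpoints. -/
theorem eq_of_local_increment_bound {D V : ℝ → ℝ} {a b : ℝ} (hab : a ≤ b)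
    (hr : ∀ ε > 0, ∀ t ∈ Ico a b, ∀ᶠ s in 𝓝[>] t, |D s - D t| ≤ ε * (V s - V t))
    (hl : ∀ ε > 0, ∀ t ∈ Ioc a b, ∀ᶠ s in 𝓝[<] t, |D t - D s| ≤ ε * (V t - V s)) :
    D b = D a := by
  have key : ∀ ε > 0, ∀ t ∈ Icc a b, |D t - D a| ≤ ε * (V t - V a) := by
    intro ε hε
    by_contra! hcon
    obtain ⟨t₁, ht₁, hbad₁⟩ := hcon
    -- Continuous induction: the left-hand bound shows that the infimum of the violating times is
    -- not violating, and the right-hand bound then protects a right neighbourhood of it, so it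
    -- cannot be the infimum.
    set S : Set ℝ := {t | t ∈ Icc a b ∧ ε * (V t - V a) < |D t - D a|} with hS
    have hne : S.Nonempty := ⟨t₁, ht₁, hbad₁⟩
    have hbdd : BddBelow S := ⟨a, fun t ht => ht.1.1⟩
    set c := sInf S with hc
    have hac : a ≤ c := le_csInf hne fun t ht => ht.1.1
    have hcb : c ≤ b := (csInf_le hbdd ⟨ht₁, hbad₁⟩).trans ht₁.2
    have hlt : ∀ t ∈ Ico a c, |D t - D a| ≤ ε * (V t - V a) := by
      intro t ht
      by_contra! h
      exact absurd (csInf_le hbdd ⟨⟨ht.1, ht.2.le.trans hcb⟩, h⟩) (not_le.2 ht.2)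
    have hPc : |D c - D a| ≤ ε * (V c - V a) := by
      rcases hac.eq_or_lt with h | h
      · simp [← h]
      · have h1 := hl ε hε c ⟨h, hcb⟩
        have h2 : ∀ᶠ s in 𝓝[<] c, s ∈ Ico a c := Ico_mem_nhdsLT h
        obtain ⟨s, hs1, hs2⟩ := (h1.and h2).exists
        have h3 := hlt s hs2
        have : D c - D a = (D c - D s) + (D s - D a) := by ring
        rw [this]
        refine (abs_add_le _ _).trans ?_
        linarith
    have hcb' : c < b := by
      refine lt_of_le_of_ne hcb fun h => ?_
      have h1 : t₁ = c := le_antisymm (h ▸ ht₁.2) (csInf_le hbdd ⟨ht₁, hbad₁⟩)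
      rw [h1] at hbad₁
      linarith
    have h1 := hr ε hε c ⟨hac, hcb'⟩
    obtain ⟨u, hu, hu'⟩ := (mem_nhdsGT_iff_exists_Ioo_subset).1 h1
    obtain ⟨s, hs, hsu⟩ := exists_lt_of_csInf_lt hne (show sInf S < u from hu)
    have hcs : c ≤ s := csInf_le hbdd hs
    have hPs : |D s - D a| ≤ ε * (V s - V a) := by
      rcases hcs.eq_or_lt with h | h
      · rwa [← h]
      · have h3 : |D s - D c| ≤ ε * (V s - V c) := hu' ⟨h, hsu⟩
        have : D s - D a = (D s - D c) + (D c - D a) := by ring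
        rw [this]
        refine (abs_add_le _ _).trans ?_
        linarith
    exact absurd hs.2 (not_lt.2 hPs)
  -- `V` does not depend on `ε`, so `ε` can now tend to `0`.
  have hb : ∀ ε > 0, |D b - D a| ≤ ε * (V b - V a) := fun ε hε => key ε hε b ⟨hab, le_rfl⟩
  have h0 : |D b - D a| ≤ 0 := by
    have hlim : Tendsto (fun ε : ℝ => ε * (V b - V a)) (𝓝[>] 0) (𝓝 0) := by
      have : Tendsto (fun ε : ℝ => ε * (V b - V a)) (𝓝 0) (𝓝 (0 * (V b - V a))) :=
        (continuous_id.mul continuous_const).tendsto 0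
      rw [zero_mul] at this
      exact this.mono_left nhdsWithin_le_nhds
    exact ge_of_tendsto hlim (by filter_upwards [self_mem_nhdsWithin] with ε hε using hb ε hε)
  have := abs_nonpos_iff.1 h0
  linarith

/-- If the derivative of `g` is within `ε` of `c` on the segment `[a, b]`, so is the slope. -/
theorem abs_dslope_sub_le {g g' : ℝ → ℝ} {a b c ε : ℝ}
    (hg : ∀ e ∈ uIcc a b, HasDerivAt g (g' e) e) (hc : ∀ e ∈ uIcc a b, |g' e - c| ≤ ε) :
    |dslope g a b - c| ≤ ε := by
  rcases eq_or_ne b a with rfl | hne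
  · rw [dslope_same, (hg b right_mem_uIcc).deriv]
    exact hc b right_mem_uIcc
  · rw [dslope_of_ne _ hne, slope_def_field]
    have h : ‖(g b - c * b) - (g a - c * a)‖ ≤ ε * ‖b - a‖ :=
      Convex.norm_image_sub_le_of_norm_hasDerivWithin_le (f := fun e => g e - c * e)
        (f' := fun e => g' e - c)
        (fun e he => (((hg e he).sub ((hasDerivAt_id e).const_mul c)).congr_deriv
          (by simp)).hasDerivWithinAt)
        (fun e he => hc e he) (convex_uIcc a b) left_mem_uIcc right_mem_uIcc
    have hba : b - a ≠ 0 := sub_ne_zero.2 hne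
    have : (g b - g a) / (b - a) - c = ((g b - c * b) - (g a - c * a)) / (b - a) := by
      field_simp; ring
    rw [this, abs_div, div_le_iff₀ (abs_pos.2 hba)]
    exact h

/-- A function with strictly increasing derivative lies strictly above its tangents. -/
theorem lt_of_strictMono_hasDerivAt {g g' : ℝ → ℝ} (hg : ∀ y, HasDerivAt g (g' y) y)
    (hg' : StrictMono g') {w y : ℝ} (hne : y ≠ w) :
    g w + g' w * (y - w) < g y := by
  rcases lt_or_gt_of_ne hne with h | h
  · obtain ⟨c, hc, hc'⟩ := exists_hasDerivAt_eq_slope g g' h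
      (fun x _ => (hg x).continuousAt.continuousWithinAt) fun x _ => hg x
    have h1 : g' c < g' w := hg' hc.2
    rw [hc', div_lt_iff₀ (by linarith)] at h1
    linarith
  · obtain ⟨c, hc, hc'⟩ := exists_hasDerivAt_eq_slope g g' h
      (fun x _ => (hg x).continuousAt.continuousWithinAt) fun x _ => hg x
    have h1 : g' w < g' c := hg' hc.1
    rw [hc', lt_div_iff₀ (by linarith)] at h1
    linarith

theorem le_of_strictMono_hasDerivAt {g g' : ℝ → ℝ} (hg : ∀ y, HasDerivAt g (g' y) y)
    (hg' : StrictMono g') (w y : ℝ) : g w + g' w * (y - w) ≤ g y := by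
  rcases eq_or_ne y w with rfl | h
  · simp
  · exact (lt_of_strictMono_hasDerivAt hg hg' h).le

/-! ### Functions of bounded variation -/

theorem boundedVariationOn_add {f g : ℝ → ℝ} {s : Set ℝ} (hf : BoundedVariationOn f s)
    (hg : BoundedVariationOn g s) : BoundedVariationOn (fun t => f t + g t) s := by
  have : eVariationOn (fun t => f t + g t) s ≤ eVariationOn f s + eVariationOn g s := by
    refine iSup_le fun p => ?_
    calc ∑ i ∈ Finset.range p.1, edist (f (p.2.1 (i + 1)) + g (p.2.1 (i + 1)))
          (f (p.2.1 i) + g (p.2.1 i))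
        ≤ ∑ i ∈ Finset.range p.1, (edist (f (p.2.1 (i + 1))) (f (p.2.1 i)) +
          edist (g (p.2.1 (i + 1))) (g (p.2.1 i))) :=
          Finset.sum_le_sum fun i _ => edist_add_add_le _ _ _ _
      _ ≤ _ := by
          rw [Finset.sum_add_distrib]
          exact add_le_add (eVariationOn.sum_le p.2.2.1 p.2.2.2)
            (eVariationOn.sum_le p.2.2.1 p.2.2.2)
  exact ne_top_of_le_ne_top (ENNReal.add_ne_top.2 ⟨hf, hg⟩) this

theorem boundedVariationOn_of_monotone {g : ℝ → ℝ} {c d : ℝ} (hg : Monotone g)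
    (hc : ∀ t, c ≤ g t) (hd : ∀ t, g t ≤ d) : BoundedVariationOn g univ := by
  have : eVariationOn g univ ≤ ENNReal.ofReal (d - c) := by
    rw [eVariationOn.eq_biSup_inter_Icc]
    refine iSup₂_le fun p hp => ?_
    rw [(hg.monotoneOn univ).eVariationOn_eq hp.1 hp.2.1]
    exact ENNReal.ofReal_le_ofReal (by linarith [hc p.1, hd p.2])
  exact ne_top_of_le_ne_top ENNReal.ofReal_ne_top this

theorem boundedVariationOn_const (c : ℝ) : BoundedVariationOn (fun _ : ℝ => c) univ :=
  boundedVariationOn_of_monotone monotone_const (fun _ => le_rfl) fun _ => le_rfl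

section BoundedVariation

variable {X : ℝ → ℝ}

theorem exists_monotone_sub (hX : BoundedVariationOn X univ) :
    ∃ p q : ℝ → ℝ, Monotone p ∧ Monotone q ∧ X = p - q := by
  obtain ⟨p, q, hp, hq, hpq⟩ := hX.locallyBoundedVariationOn.exists_monotoneOn_sub_monotoneOn
  exact ⟨p, q, monotoneOn_univ.1 hp, monotoneOn_univ.1 hq, hpq⟩

theorem measurable_of_boundedVariationOn (hX : BoundedVariationOn X univ) : Measurable X := by
  obtain ⟨p, q, hp, hq, rfl⟩ := exists_monotone_sub hX
  exact hp.measurable.sub hq.measurable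

theorem countable_not_continuousAt (hX : BoundedVariationOn X univ) :
    {t | ¬ ContinuousAt X t}.Countable := by
  obtain ⟨p, q, hp, hq, rfl⟩ := exists_monotone_sub hX
  refine (hp.countable_not_continuousAt.union hq.countable_not_continuousAt).mono ?_
  intro t ht
  by_contra h
  simp only [mem_union, mem_ofPred_eq, not_or, not_not] at h
  exact ht (h.1.sub h.2)

theorem abs_sub_le_of_eVariationOn_le {M : ℝ≥0} (hX : eVariationOn X univ ≤ M) (s t : ℝ) :
    |X s - X t| ≤ M := by
  have h := (eVariationOn.edist_le X (mem_univ s) (mem_univ t)).trans hX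
  rw [edist_nndist, ENNReal.coe_le_coe] at h
  rw [← Real.dist_eq]
  exact_mod_cast h

theorem tendsto_rightLim_nhdsGT (hX : BoundedVariationOn X univ) (t : ℝ) :
    Tendsto (Function.rightLim X) (𝓝[>] t) (𝓝 (Function.rightLim X t)) :=
  (hX.continuousWithinAt_rightLim (x := t)).tendsto.mono_left
    (nhdsWithin_mono _ Ioi_subset_Ici_self)

theorem tendsto_rightLim_nhdsLT (hX : BoundedVariationOn X univ)
    (hl : ∀ t, ContinuousWithinAt X (Iic t) t) (t : ℝ) :
    Tendsto (Function.rightLim X) (𝓝[<] t) (𝓝 (X t)) := by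
  have h := hX.rightLim.tendsto_leftLim t
  rwa [leftLim_rightLim (hX.tendsto_leftLim t), (hl t).leftLim_eq] at h

theorem jump_eq_zero_of_continuousAt {t : ℝ} (h : ContinuousAt X t) : jump X t = 0 := by
  rw [jump, h.continuousWithinAt.rightLim_eq, sub_self]

theorem pathMeasure_eq (hX : BoundedVariationOn X univ) : pathMeasure X = hX.vectorMeasure := by
  rw [pathMeasure, dif_pos hX]

theorem pathMeasure_singleton (hX : BoundedVariationOn X univ)
    (hl : ∀ t, ContinuousWithinAt X (Iic t) t) (t : ℝ) : pathMeasure X {t} = jump X t := by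
  rw [pathMeasure_eq hX, hX.vectorMeasure_singleton, (hl t).leftLim_eq, jump]

theorem pathMeasure_Ico (hX : BoundedVariationOn X univ)
    (hl : ∀ t, ContinuousWithinAt X (Iic t) t) {s t : ℝ} (h : s ≤ t) :
    pathMeasure X (Ico s t) = X t - X s := by
  rw [pathMeasure_eq hX, hX.vectorMeasure_Ico h, (hl t).leftLim_eq, (hl s).leftLim_eq]

theorem pathMeasure_Ioo (hX : BoundedVariationOn X univ)
    (hl : ∀ t, ContinuousWithinAt X (Iic t) t) {s t : ℝ} (h : s < t) :
    pathMeasure X (Ioo s t) = X t - (X s + jump X s) := by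
  rw [pathMeasure_eq hX, hX.vectorMeasure_Ioo h, (hl t).leftLim_eq, jump]
  ring

end BoundedVariation

instance isFiniteMeasure_variation (m : SignedMeasure ℝ) : IsFiniteMeasure m.variation := by
  rw [← SignedMeasure.totalVariation_eq_variation]
  infer_instance

/-! ### A chain rule for left-continuous paths of bounded variation -/

/-- The coefficients are frozen at a pivot: `θ` and `v` are compared with `ce`, `u` with `ct`. The
frozen parts cancel against the linear approximation of the increment of `Φ` because `eq - ep = m I
- ∫ r`. The endpoint values are kept abstract because to the right of a jump the starting value is
the one after the jump. -/
theorem abs_increment_sub_integral_le {m : SignedMeasure ℝ} {I : Set ℝ}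
    {θ u v r : ℝ → ℝ} {p q ce ct ε C ep eq Φp Φq : ℝ} (hpq : p ≤ q)
    (hθ : m.IntegrableOn θ I) (hθε : ∀ t ∈ I, |θ t - ce| ≤ ε)
    (hu : IntervalIntegrable u volume p q) (huε : ∀ t ∈ Ioc p q, |u t - ct| ≤ ε)
    (hv : IntervalIntegrable (fun t => v t * r t) volume p q)
    (hvε : ∀ t ∈ Ioc p q, |v t - ce| ≤ ε)
    (hr : IntervalIntegrable r volume p q) (hrC : ∀ t ∈ Ioc p q, |r t| ≤ C)
    (heq : eq - ep = m I - ∫ t in p..q, r t) (hε : 0 ≤ ε)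
    (hΦ : |Φq - Φp - (ct * (q - p) + ce * (eq - ep))| ≤ ε * (|q - p| + |eq - ep|)) :
    |Φq - Φp - (∫ᵛ t in I, θ t ∂•m) - ∫ t in p..q, (u t - v t * r t)| ≤
      ε * (2 * m.variation.real I + 2 * (1 + C) * (q - p)) := by
  have hc : m.IntegrableOn (fun _ => ce) I := by
    simp only [VectorMeasure.IntegrableOn, VectorMeasure.Integrable]
    exact integrable_const _
  have h1 : (∫ᵛ t in I, θ t ∂•m) - ce * m I = ∫ᵛ t in I, (θ t - ce) ∂•m := by
    rw [VectorMeasure.integral_fun_sub hθ hc, VectorMeasure.setIntegral_const]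
    simp
  have h1' : |∫ᵛ t in I, (θ t - ce) ∂•m| ≤ ε * m.variation.real I := by
    have h := VectorMeasure.norm_setIntegral_le_of_norm_le_const (μ := m) (s := I)
      (f := fun t => θ t - ce) (B := ContinuousLinearMap.lsmul ℝ ℝ) (C := ε) hθε
    refine h.trans ?_
    have h2 : ‖(ContinuousLinearMap.lsmul ℝ ℝ : ℝ →L[ℝ] ℝ →L[ℝ] ℝ)‖ ≤ 1 :=
      ContinuousLinearMap.opNorm_lsmul_le
    have := measureReal_nonneg (μ := m.variation) (s := I)
    nlinarith [mul_nonneg hε this]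
  have h2 : (∫ t in p..q, (u t - v t * r t)) - ct * (q - p) + ce * (∫ t in p..q, r t) =
      ∫ t in p..q, ((u t - v t * r t) - ct + ce * r t) := by
    rw [intervalIntegral.integral_add ((hu.sub hv).sub intervalIntegrable_const) (hr.const_mul ce),
      intervalIntegral.integral_sub (hu.sub hv) intervalIntegrable_const,
      intervalIntegral.integral_const_mul, intervalIntegral.integral_const, smul_eq_mul]
    ring
  have h2' : |∫ t in p..q, ((u t - v t * r t) - ct + ce * r t)| ≤ ε * (1 + C) * (q - p) := by
    have := intervalIntegral.norm_integral_le_of_norm_le_const (a := p) (b := q)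
      (f := fun t => (u t - v t * r t) - ct + ce * r t) (C := ε * (1 + C)) (fun t ht => by
        rw [uIoc_of_le hpq] at ht
        rw [show u t - v t * r t - ct + ce * r t = (u t - ct) - (v t - ce) * r t by ring]
        refine (norm_sub_le _ _).trans ?_
        rw [norm_mul]
        have h3 : |v t - ce| * |r t| ≤ ε * C :=
          mul_le_mul (hvε t ht) (hrC t ht) (abs_nonneg _) hε
        have h4 := huε t ht
        simp only [Real.norm_eq_abs]
        linarith)
    rwa [abs_of_nonneg (sub_nonneg.2 hpq)] at this
  have h3 : |eq - ep| ≤ m.variation.real I + C * (q - p) := by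
    rw [heq]
    refine (abs_sub _ _).trans (add_le_add ?_ ?_)
    · exact VectorMeasure.norm_measure_le_variation (μ := m) (E := I) (measure_ne_top _ _)
    · have := intervalIntegral.norm_integral_le_of_norm_le_const (a := p) (b := q) (f := r)
        (C := C) (fun t ht => hrC t (by rwa [uIoc_of_le hpq] at ht))
      rwa [abs_of_nonneg (sub_nonneg.2 hpq)] at this
  rw [abs_of_nonneg (sub_nonneg.2 hpq)] at hΦ
  -- Three errors: the linearisation of `Φ`, the freezing of `θ`, and the freezing of `u - v r`. The
  -- first is at most `ε` times `(q - p) + |m|(I) + C (q - p)`, which accounts for the factors `2`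
  -- in the bound.
  have h4 : Φq - Φp - (∫ᵛ t in I, θ t ∂•m) - ∫ t in p..q, (u t - v t * r t) =
      (Φq - Φp - (ct * (q - p) + ce * (eq - ep))) - (∫ᵛ t in I, (θ t - ce) ∂•m) -
      ∫ t in p..q, ((u t - v t * r t) - ct + ce * r t) := by
    rw [← h1, ← h2, heq]; ring
  rw [h4]
  refine (abs_sub _ _).trans ?_
  refine (add_le_add_left (abs_sub _ _) _).trans ?_
  have h5 : ε * (q - p + |eq - ep|) ≤ ε * (q - p + (m.variation.real I + C * (q - p))) := by
    gcongr
  nlinarith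

/-- The path `X_t - X_0 - ∫₀ᵗ r_s ds`. -/
def driftPath (X r : ℝ → ℝ) (t : ℝ) : ℝ := X t - X 0 - ∫ s in (0 : ℝ)..t, r s

/-! ### One-sided limits and bounds for the path `E = X - X_0 - ∫ r`, and the chain rule -/

section ChainRule

variable {X r : ℝ → ℝ}

theorem measurable_driftPath (hX : BoundedVariationOn X univ)
    (hr : ∀ a b, IntervalIntegrable r volume a b) : Measurable (driftPath X r) :=
  ((measurable_of_boundedVariationOn hX).sub_const _).sub
    (intervalIntegral.continuous_primitive hr 0).measurable

theorem tendsto_driftPath_nhdsGT (hX : BoundedVariationOn X univ)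
    (hr : ∀ a b, IntervalIntegrable r volume a b) (t : ℝ) :
    Tendsto (driftPath X r) (𝓝[>] t) (𝓝 (driftPath X r t + jump X t)) := by
  have h1 := hX.tendsto_rightLim t
  have h2 := ((intervalIntegral.continuous_primitive hr 0).tendsto t).mono_left
    (nhdsWithin_le_nhds (s := Ioi t))
  have := (h1.sub_const (X 0)).sub h2
  convert! this using 2
  simp only [driftPath, jump]; ring

theorem tendsto_driftPath_nhdsLT (hl : ∀ t, ContinuousWithinAt X (Iic t) t)
    (hr : ∀ a b, IntervalIntegrable r volume a b) (t : ℝ) :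
    Tendsto (driftPath X r) (𝓝[<] t) (𝓝 (driftPath X r t)) := by
  have h1 := (hl t).tendsto.mono_left (nhdsWithin_mono t Iio_subset_Iic_self)
  have h2 := ((intervalIntegral.continuous_primitive hr 0).tendsto t).mono_left
    (nhdsWithin_le_nhds (s := Iio t))
  exact (h1.sub_const (X 0)).sub h2

theorem tendsto_driftPath_add_jump_nhdsGT (hX : BoundedVariationOn X univ)
    (hr : ∀ a b, IntervalIntegrable r volume a b) (t : ℝ) :
    Tendsto (fun s => driftPath X r s + jump X s) (𝓝[>] t)
      (𝓝 (driftPath X r t + jump X t)) := by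
  have h1 := tendsto_rightLim_nhdsGT hX t
  have h2 := ((intervalIntegral.continuous_primitive hr 0).tendsto t).mono_left
    (nhdsWithin_le_nhds (s := Ioi t))
  have := (h1.sub_const (X 0)).sub h2
  convert! this using 2
  · simp only [driftPath, jump]; ring
  · simp only [driftPath, jump]; ring

/-- Jumps at times approaching `t` fade away, so the values after the jump have the same left limit
as `E` itself. Near `t` the whole segment crossed by a jump is then close to the pivot, which is
what controls `jumpSlope`. -/
theorem tendsto_driftPath_add_jump_nhdsLT (hX : BoundedVariationOn X univ)
    (hl : ∀ t, ContinuousWithinAt X (Iic t) t)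
    (hr : ∀ a b, IntervalIntegrable r volume a b) (t : ℝ) :
    Tendsto (fun s => driftPath X r s + jump X s) (𝓝[<] t) (𝓝 (driftPath X r t)) := by
  have h1 := tendsto_rightLim_nhdsLT hX hl t
  have h2 := ((intervalIntegral.continuous_primitive hr 0).tendsto t).mono_left
    (nhdsWithin_le_nhds (s := Iio t))
  have := (h1.sub_const (X 0)).sub h2
  convert! this using 2
  simp only [driftPath, jump]; ring

theorem exists_bound_driftPath (hX : BoundedVariationOn X univ)
    (hr : ∀ a b, IntervalIntegrable r volume a b) (T : ℝ) :
    ∃ K, ∀ t ∈ Icc 0 T, |driftPath X r t| ≤ K ∧ |driftPath X r t + jump X t| ≤ K := by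
  obtain ⟨A, hA⟩ := isCompact_Icc.exists_bound_of_continuousOn
    (intervalIntegral.continuous_primitive hr 0).continuousOn (s := Icc 0 T)
  have hM : eVariationOn X univ ≤ ((eVariationOn X univ).toNNReal : ℝ≥0∞) :=
    (ENNReal.coe_toNNReal hX).ge
  set M := (eVariationOn X univ).toNNReal
  have h1 : ∀ t, |X t - X 0| ≤ M := fun t => abs_sub_le_of_eVariationOn_le hM t 0
  have h2 : ∀ t, |Function.rightLim X t - X 0| ≤ M := fun t =>
    le_of_tendsto ((hX.tendsto_rightLim t).sub_const (X 0)).abs (Eventually.of_forall h1)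
  refine ⟨M + A, fun t ht => ⟨?_, ?_⟩⟩
  · exact (abs_sub _ _).trans (add_le_add (h1 t) (hA t ht))
  · rw [show driftPath X r t + jump X t = (Function.rightLim X t - X 0) -
      ∫ s in (0 : ℝ)..t, r s by simp only [driftPath, jump]; ring]
    exact (abs_sub _ _).trans (add_le_add (h2 t) (hA t ht))

theorem abs_sub_le_max_of_mem_uIcc {a b c e : ℝ} (he : e ∈ uIcc a b) :
    |e - c| ≤ max |a - c| |b - c| := by
  obtain ⟨h1, h2⟩ : min a b ≤ e ∧ e ≤ max a b := he
  rw [abs_le]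
  rcases le_total a b with h | h
  · rw [min_eq_left h] at h1; rw [max_eq_right h] at h2
    exact ⟨by linarith [neg_abs_le (a - c), le_max_left |a - c| |b - c|],
      by linarith [le_abs_self (b - c), le_max_right |a - c| |b - c|]⟩
  · rw [min_eq_right h] at h1; rw [max_eq_left h] at h2
    exact ⟨by linarith [neg_abs_le (b - c), le_max_right |a - c| |b - c|],
      by linarith [le_abs_self (a - c), le_max_left |a - c| |b - c|]⟩

/-- The slope of `Φ (t, ·)` across the jump of the path at time `t`. -/
def jumpSlope (Φ : ℝ × ℝ → ℝ) (X r : ℝ → ℝ) (t : ℝ) : ℝ :=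
  dslope (fun e => Φ (t, e)) (driftPath X r t) (driftPath X r t + jump X t)

variable {Φ Φt Φe : ℝ × ℝ → ℝ} {T C : ℝ}

/-- The slope times the atom of `dX` is the exact increment of `Φ` across the jump, while without a
jump the slope is the partial derivative. A single integral against `dX` thus carries both the
continuous part and the jumps of the cost. -/
theorem jumpSlope_mul_jump (t : ℝ) :
    jumpSlope Φ X r t * jump X t =
      Φ (t, driftPath X r t + jump X t) - Φ (t, driftPath X r t) := by
  have := sub_smul_dslope (fun e => Φ (t, e)) (driftPath X r t) (driftPath X r t + jump X t)
  simp only [smul_eq_mul, add_sub_cancel_left] at this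
  rw [jumpSlope, mul_comm, this]

theorem jumpSlope_of_jump_eq_zero {t : ℝ}
    (hΦ : ∀ e, HasDerivAt (fun e => Φ (t, e)) (Φe (t, e)) e) (h : jump X t = 0) :
    jumpSlope Φ X r t = Φe (t, driftPath X r t) := by
  rw [jumpSlope, h, add_zero, dslope_same, (hΦ _).deriv]

theorem integrableOn_of_bounded {m : SignedMeasure ℝ} {g : ℝ → ℝ} {I : Set ℝ}
    (hI : MeasurableSet I) {B : ℝ} (hg : AEStronglyMeasurable g (m.variation.restrict I))
    (hB : ∀ t ∈ I, |g t| ≤ B) : m.IntegrableOn g I := by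
  simp only [VectorMeasure.IntegrableOn, VectorMeasure.Integrable, VectorMeasure.variation_restrict hI]
  exact Integrable.of_bound hg B ((ae_restrict_iff' hI).2 (Eventually.of_forall hB))

/-- Measurability holds because on `[0, T]` the slope differs from `Φe (t, E_t)` only at the
countably many discontinuities of `X`; boundedness holds because slopes are bounded by the
derivative on the compact range of `E` before and after jumps. -/
theorem integrableOn_jumpSlope (hX : BoundedVariationOn X univ)
    (hr : ∀ a b, IntervalIntegrable r volume a b)
    (hΦ : ∀ t ∈ Icc 0 T, ∀ e, HasDerivAt (fun e => Φ (t, e)) (Φe (t, e)) e)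
    (hΦe : Continuous Φe) (m : SignedMeasure ℝ) :
    m.IntegrableOn (jumpSlope Φ X r) (Icc 0 T) := by
  obtain ⟨K, hK⟩ := exists_bound_driftPath hX hr T
  obtain ⟨B, hB⟩ := (isCompact_Icc.prod (isCompact_Icc (a := -K) (b := K))).exists_bound_of_continuousOn
    hΦe.continuousOn (s := Icc 0 T ×ˢ Icc (-K) K)
  refine integrableOn_of_bounded measurableSet_Icc (B := B) ?_ fun t ht => ?_
  · have h1 : Measurable (indicator (Icc 0 T) fun t => Φe (t, driftPath X r t)) :=
      (hΦe.measurable.comp (measurable_id.prodMk (measurable_driftPath hX hr))).indicator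
        measurableSet_Icc
    have h2 : Measurable (indicator (Icc 0 T) (jumpSlope Φ X r)) := by
      refine h1.measurable_of_countable_ne ((countable_not_continuousAt hX).mono fun t ht => ?_)
      intro hc
      refine ht ?_
      by_cases htI : t ∈ Icc 0 T
      · rw [indicator_of_mem htI, indicator_of_mem htI,
          jumpSlope_of_jump_eq_zero (hΦ t htI) (jump_eq_zero_of_continuousAt hc)]
      · rw [indicator_of_notMem htI, indicator_of_notMem htI]
    refine h2.aestronglyMeasurable.congr ?_
    filter_upwards [ae_restrict_mem measurableSet_Icc] with t ht
    rw [indicator_of_mem ht]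
  · have := abs_dslope_sub_le (c := 0) (ε := B) (a := driftPath X r t)
      (b := driftPath X r t + jump X t) (fun e _ => hΦ t ht e) (fun e he => ?_)
    · simpa using! this
    · rw [sub_zero]
      refine hB (t, e) ⟨ht, ?_⟩
      have h1 := abs_sub_le_max_of_mem_uIcc (c := 0) he
      simp only [sub_zero] at h1
      exact abs_le.1 (h1.trans (max_le (hK t ht).1 (hK t ht).2))

theorem exists_bound_comp_driftPath (hX : BoundedVariationOn X univ)
    (hr : ∀ a b, IntervalIntegrable r volume a b) {Ψ : ℝ × ℝ → ℝ} (hΨ : Continuous Ψ) (T : ℝ) :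
    ∃ B, ∀ t ∈ Icc 0 T, |Ψ (t, driftPath X r t)| ≤ B := by
  obtain ⟨K, hK⟩ := exists_bound_driftPath hX hr T
  obtain ⟨B, hB⟩ := (isCompact_Icc.prod (isCompact_Icc (a := -K) (b := K))).exists_bound_of_continuousOn
    hΨ.continuousOn (s := Icc 0 T ×ˢ Icc (-K) K)
  exact ⟨B, fun t ht => hB _ ⟨ht, abs_le.1 (hK t ht).1⟩⟩

theorem integrableOn_comp_driftPath (hX : BoundedVariationOn X univ)
    (hr : ∀ a b, IntervalIntegrable r volume a b) {Ψ : ℝ × ℝ → ℝ} (hΨ : Continuous Ψ) :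
    IntegrableOn (fun t => Ψ (t, driftPath X r t)) (Icc 0 T) := by
  obtain ⟨B, hB⟩ := exists_bound_comp_driftPath hX hr hΨ T
  refine Measure.integrableOn_of_bounded (M := B) (by simp)
    (hΨ.measurable.comp (measurable_id.prodMk
      (measurable_driftPath hX hr))).aestronglyMeasurable ?_
  exact (ae_restrict_iff' measurableSet_Icc).2 (Eventually.of_forall hB)

theorem smul_fst_add_smul_snd_apply {c₁ c₂ a b : ℝ} :
    (c₁ • ContinuousLinearMap.fst ℝ ℝ ℝ + c₂ • ContinuousLinearMap.snd ℝ ℝ ℝ) (a, b) =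
      c₁ * a + c₂ * b := by
  simp

/-- The chain rule for `Φ (t, E_t)`, where `E` solves `dE = dX - r dt`. -/
theorem chain_rule (hT : 0 ≤ T) (hX : BoundedVariationOn X univ)
    (hl : ∀ t, ContinuousWithinAt X (Iic t) t)
    (hr : ∀ a b, IntervalIntegrable r volume a b) (hrC : ∀ t, |r t| ≤ C)
    (hΦ : ∀ p ∈ Icc 0 T ×ˢ (univ : Set ℝ), HasFDerivWithinAt Φ
      (Φt p • ContinuousLinearMap.fst ℝ ℝ ℝ + Φe p • ContinuousLinearMap.snd ℝ ℝ ℝ)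
      (Icc 0 T ×ˢ univ) p)
    (hΦe' : ∀ t ∈ Icc 0 T, ∀ e, HasDerivAt (fun e => Φ (t, e)) (Φe (t, e)) e)
    (hΦt : Continuous Φt) (hΦe : Continuous Φe) :
    (∫ᵛ t in Icc 0 T, jumpSlope Φ X r t ∂•(pathMeasure X)) =
      Φ (T, driftPath X r T + jump X T) - Φ (0, driftPath X r 0) -
      ∫ t in (0 : ℝ)..T, (Φt (t, driftPath X r t) - Φe (t, driftPath X r t) * r t) := by
  set E := driftPath X r with hE
  set m := pathMeasure X with hm
  set θ := jumpSlope Φ X r with hθ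
  have hθi : m.IntegrableOn θ (Icc 0 T) := integrableOn_jumpSlope hX hr hΦe' hΦe m
  have hθs : ∀ {I : Set ℝ}, I ⊆ Icc 0 T → m.IntegrableOn θ I := fun hI =>
    hθi.mono measurableSet_Icc hI
  have hui : ∀ a ∈ Icc 0 T, ∀ b ∈ Icc 0 T,
      IntervalIntegrable (fun t => Φt (t, E t)) volume a b := fun a ha b hb =>
    ((integrableOn_comp_driftPath hX hr hΦt).mono_set (uIcc_subset_Icc ha hb)).intervalIntegrable
  have hvi : ∀ a ∈ Icc 0 T, ∀ b ∈ Icc 0 T,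
      IntervalIntegrable (fun t => Φe (t, E t) * r t) volume a b := fun a ha b hb => by
    obtain ⟨B, hB⟩ := exists_bound_comp_driftPath hX hr hΦe T
    have h1 := (hr a b).def'.bdd_mul (c := B) (f := fun t => Φe (t, E t))
      ((hΦe.measurable.comp (measurable_id.prodMk
        (measurable_driftPath hX hr))).aestronglyMeasurable)
      ((ae_restrict_iff' measurableSet_uIoc).2 (Eventually.of_forall fun t ht =>
        hB t (uIcc_subset_Icc ha hb (uIoc_subset_uIcc ht))))
    exact intervalIntegrable_iff.2 h1
  set w : ℝ → ℝ := fun t => Φt (t, E t) - Φe (t, E t) * r t with hw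
  have hwi : ∀ a ∈ Icc 0 T, ∀ b ∈ Icc 0 T, IntervalIntegrable w volume a b :=
    fun a ha b hb => (hui a ha b hb).sub (hvi a ha b hb)
  have h0T : (0 : ℝ) ∈ Icc 0 T := ⟨le_rfl, hT⟩
  -- `D` is the defect of the chain rule up to time `s`, with the atom at `s` excluded since `E` is
  -- left-continuous. `V` has the increments that appear in `abs_increment_sub_integral_le`.
  set D : ℝ → ℝ := fun s => Φ (s, E s) - (∫ᵛ t in Ico 0 s, θ t ∂•m) -
    ∫ t in (0 : ℝ)..s, w t with hD
  set V : ℝ → ℝ := fun s => 2 * m.variation.real (Iio s) + 2 * (1 + C) * s with hV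
  have hDsub : ∀ a ∈ Icc 0 T, ∀ b ∈ Icc 0 T, a ≤ b → D b - D a =
      Φ (b, E b) - Φ (a, E a) - (∫ᵛ t in Ico a b, θ t ∂•m) - ∫ t in a..b, w t := by
    intro a ha b hb hab
    have h1 : (∫ᵛ t in Ico 0 b, θ t ∂•m) =
        (∫ᵛ t in Ico 0 a, θ t ∂•m) + ∫ᵛ t in Ico a b, θ t ∂•m := by
      rw [← Ico_union_Ico_eq_Ico ha.1 hab]
      refine VectorMeasure.setIntegral_union ?_ measurableSet_Ico measurableSet_Ico
        (hθs fun t ht => ⟨ht.1, ht.2.le.trans ha.2⟩)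
        (hθs fun t ht => ⟨ha.1.trans ht.1, ht.2.le.trans hb.2⟩)
      exact Ico_disjoint_Ico_same
    have h2 := intervalIntegral.integral_add_adjacent_intervals (hwi 0 h0T a ha) (hwi a ha b hb)
    simp only [hD, h1, ← h2]
    ring
  have hVsub : ∀ a b, a ≤ b →
      V b - V a = 2 * m.variation.real (Ico a b) + 2 * (1 + C) * (b - a) := by
    intro a b hab
    have : m.variation.real (Iio b) = m.variation.real (Iio a) + m.variation.real (Ico a b) := by
      rw [← Iio_union_Ico_eq_Iio hab]
      exact measureReal_union (by
        rw [Set.disjoint_left]; exact fun x hx hx' => not_lt.2 hx'.1 hx) measurableSet_Ico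
    simp only [hV, this]; ring
  have hsing : ∀ t, (∫ᵛ s in {t}, θ s ∂•m) = Φ (t, E t + jump X t) - Φ (t, E t) := by
    intro t
    rw [VectorMeasure.integral_singleton, hm, pathMeasure_singleton hX hl, ← jumpSlope_mul_jump]
    simp [hθ]
  -- uniform closeness near a pivot
  have hnear : ∀ ε > 0, ∀ t₀ e₀ : ℝ, ∃ δ > 0, ∀ t e, |t - t₀| < δ → |e - e₀| < δ →
      |Φe (t, e) - Φe (t₀, e₀)| ≤ ε ∧ |Φt (t, e) - Φt (t₀, e₀)| ≤ ε := by
    intro ε hε t₀ e₀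
    obtain ⟨δ₁, hδ₁, h₁⟩ := Metric.continuousAt_iff.1 (hΦe.continuousAt (x := (t₀, e₀))) ε hε
    obtain ⟨δ₂, hδ₂, h₂⟩ := Metric.continuousAt_iff.1 (hΦt.continuousAt (x := (t₀, e₀))) ε hε
    refine ⟨min δ₁ δ₂, lt_min hδ₁ hδ₂, fun t e ht he => ?_⟩
    have h3 : dist (t, e) (t₀, e₀) < min δ₁ δ₂ := by
      rw [Prod.dist_eq]; exact max_lt ht he
    exact ⟨(h₁ (h3.trans_le (min_le_left _ _))).le, (h₂ (h3.trans_le (min_le_right _ _))).le⟩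
  have hθnear : ∀ {ε δ t₀ e₀ t : ℝ}, t ∈ Icc 0 T → |t - t₀| < δ → |E t - e₀| < δ →
      |E t + jump X t - e₀| < δ →
      (∀ t e, |t - t₀| < δ → |e - e₀| < δ →
        |Φe (t, e) - Φe (t₀, e₀)| ≤ ε ∧ |Φt (t, e) - Φt (t₀, e₀)| ≤ ε) →
      |θ t - Φe (t₀, e₀)| ≤ ε := by
    intro ε δ t₀ e₀ t ht h1 h2 h3 h4
    exact abs_dslope_sub_le (fun e _ => hΦe' t ht e) fun e he =>
      (h4 t e h1 ((abs_sub_le_max_of_mem_uIcc he).trans_lt (max_lt h2 h3))).1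
  have hmain : D T = D 0 := by
    refine eq_of_local_increment_bound (V := V) hT ?_ ?_
    · intro ε hε t₀ ht₀
      have ht₀' : t₀ ∈ Icc 0 T := ⟨ht₀.1, ht₀.2.le⟩
      -- Just after `t₀` the path is near its value after the jump, so that value is the pivot.
      set e₀ := E t₀ + jump X t₀ with he₀
      obtain ⟨δ, hδ, hnb⟩ := hnear ε hε t₀ e₀
      have hE1 : Tendsto E (𝓝[>] t₀) (𝓝 e₀) := tendsto_driftPath_nhdsGT hX hr t₀
      have hE2 : Tendsto (fun s => E s + jump X s) (𝓝[>] t₀) (𝓝 e₀) :=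
        tendsto_driftPath_add_jump_nhdsGT hX hr t₀
      have hid : Tendsto (fun s : ℝ => s) (𝓝[>] t₀) (𝓝 t₀) := tendsto_id.mono_left nhdsWithin_le_nhds
      have hmemT : ∀ᶠ s in 𝓝[>] t₀, s ∈ Icc 0 T := by
        filter_upwards [Ioc_mem_nhdsGT ht₀.2] with s hs using ⟨ht₀.1.trans hs.1.le, hs.2⟩
      have hev : ∀ᶠ s in 𝓝[>] t₀, |s - t₀| < δ ∧ |E s - e₀| < δ ∧ |E s + jump X s - e₀| < δ ∧
          s ∈ Icc 0 T :=
        (hid.eventually (Metric.ball_mem_nhds _ hδ)).and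
          ((hE1.eventually (Metric.ball_mem_nhds _ hδ)).and
            ((hE2.eventually (Metric.ball_mem_nhds _ hδ)).and hmemT))
      obtain ⟨u, hu, hu'⟩ := (mem_nhdsGT_iff_exists_Ioo_subset).1 hev
      have hdiff := ((hΦ (t₀, e₀) ⟨ht₀', mem_univ _⟩).isLittleO.def hε)
      have htend : Tendsto (fun s => (s, E s)) (𝓝[>] t₀) (𝓝[Icc 0 T ×ˢ univ] (t₀, e₀)) := by
        refine tendsto_nhdsWithin_iff.2 ⟨hid.prodMk_nhds hE1, ?_⟩
        filter_upwards [hmemT] with s hs using ⟨hs, mem_univ _⟩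
      filter_upwards [htend.eventually hdiff, Ioo_mem_nhdsGT hu, hmemT] with s hs hsu hsT
      have hin : ∀ t ∈ Ioc t₀ s, |t - t₀| < δ ∧ |E t - e₀| < δ ∧ |E t + jump X t - e₀| < δ ∧
          t ∈ Icc 0 T := fun t ht => hu' ⟨ht.1, ht.2.trans_lt hsu.2⟩
      have hts : t₀ ≤ s := hsu.1.le
      have hsubI : Ioo t₀ s ⊆ Icc 0 T := fun t ht => (hin t ⟨ht.1, ht.2.le⟩).2.2.2
      have hcore := abs_increment_sub_integral_le (m := m) (I := Ioo t₀ s)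
        (θ := θ) (u := fun t => Φt (t, E t)) (v := fun t => Φe (t, E t)) (r := r)
        (ce := Φe (t₀, e₀)) (ct := Φt (t₀, e₀)) (ε := ε) (C := C) (ep := e₀) (eq := E s)
        (Φp := Φ (t₀, e₀)) (Φq := Φ (s, E s)) hts (hθs hsubI)
        (fun t ht => by
          obtain ⟨h1, h2, h3, h4⟩ := hin t ⟨ht.1, ht.2.le⟩
          exact hθnear h4 h1 h2 h3 hnb)
        (hui _ ht₀' _ hsT) (fun t ht => (hnb t (E t) (hin t ht).1 (hin t ht).2.1).2)
        (hvi _ ht₀' _ hsT) (fun t ht => (hnb t (E t) (hin t ht).1 (hin t ht).2.1).1)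
        (hr _ _) (fun t _ => hrC t)
        (by
          rw [hm, pathMeasure_Ioo hX hl hsu.1,
            ← intervalIntegral.integral_interval_sub_left (hr 0 s) (hr 0 t₀)]
          simp only [he₀, hE, driftPath]; ring)
        hε.le
        (by
          have h1 : ‖(s, E s) - (t₀, e₀)‖ ≤ |s - t₀| + |E s - e₀| := by
            rw [Prod.mk_sub_mk, Prod.norm_mk]
            exact max_le_add_of_nonneg (norm_nonneg _) (norm_nonneg _)
          rw [Prod.mk_sub_mk, smul_fst_add_smul_snd_apply, ← Prod.mk_sub_mk] at hs
          exact hs.trans (mul_le_mul_of_nonneg_left h1 hε.le))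
      rw [hDsub t₀ ht₀' s hsT hts, hVsub t₀ s hts]
      -- The atom at `t₀` reproduces the jump of `Φ` exactly, whatever its size; only the open
      -- interval needs an estimate.
      have hsplit : (∫ᵛ t in Ico t₀ s, θ t ∂•m) =
          (Φ (t₀, e₀) - Φ (t₀, E t₀)) + ∫ᵛ t in Ioo t₀ s, θ t ∂•m := by
        rw [← hsing, ← VectorMeasure.setIntegral_union (by simp) (measurableSet_singleton _)
          measurableSet_Ioo (hθs (by simpa using ht₀')) (hθs hsubI), singleton_union,
          Ioo_insert_left hsu.1]
      have hVle : m.variation.real (Ioo t₀ s) ≤ m.variation.real (Ico t₀ s) :=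
        measureReal_mono Ioo_subset_Ico_self
      rw [hsplit]
      have heq : Φ (s, E s) - Φ (t₀, E t₀) - (Φ (t₀, e₀) - Φ (t₀, E t₀) +
          ∫ᵛ t in Ioo t₀ s, θ t ∂•m) - (∫ t in t₀..s, w t) =
          Φ (s, E s) - Φ (t₀, e₀) - (∫ᵛ t in Ioo t₀ s, θ t ∂•m) - ∫ t in t₀..s, w t := by ring
      rw [heq]
      refine hcore.trans (mul_le_mul_of_nonneg_left ?_ hε.le)
      linarith
    · intro ε hε t₀ ht₀
      have ht₀' : t₀ ∈ Icc 0 T := ⟨ht₀.1.le, ht₀.2⟩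
      set e₀ := E t₀ with he₀
      obtain ⟨δ, hδ, hnb⟩ := hnear ε hε t₀ e₀
      have hE1 : Tendsto E (𝓝[<] t₀) (𝓝 e₀) := tendsto_driftPath_nhdsLT hl hr t₀
      have hE2 : Tendsto (fun s => E s + jump X s) (𝓝[<] t₀) (𝓝 e₀) :=
        tendsto_driftPath_add_jump_nhdsLT hX hl hr t₀
      have hid : Tendsto (fun s : ℝ => s) (𝓝[<] t₀) (𝓝 t₀) := tendsto_id.mono_left nhdsWithin_le_nhds
      have hmemT : ∀ᶠ s in 𝓝[<] t₀, s ∈ Icc 0 T := by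
        filter_upwards [Ico_mem_nhdsLT ht₀.1] with s hs using ⟨hs.1, hs.2.le.trans ht₀.2⟩
      have hev : ∀ᶠ s in 𝓝[<] t₀, |s - t₀| < δ ∧ |E s - e₀| < δ ∧ |E s + jump X s - e₀| < δ ∧
          s ∈ Icc 0 T :=
        (hid.eventually (Metric.ball_mem_nhds _ hδ)).and
          ((hE1.eventually (Metric.ball_mem_nhds _ hδ)).and
            ((hE2.eventually (Metric.ball_mem_nhds _ hδ)).and hmemT))
      obtain ⟨u, hu, hu'⟩ := (mem_nhdsLT_iff_exists_Ioo_subset).1 hev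
      have hdiff := ((hΦ (t₀, e₀) ⟨ht₀', mem_univ _⟩).isLittleO.def hε)
      have htend : Tendsto (fun s => (s, E s)) (𝓝[<] t₀) (𝓝[Icc 0 T ×ˢ univ] (t₀, e₀)) := by
        refine tendsto_nhdsWithin_iff.2 ⟨hid.prodMk_nhds hE1, ?_⟩
        filter_upwards [hmemT] with s hs using ⟨hs, mem_univ _⟩
      filter_upwards [htend.eventually hdiff, Ioo_mem_nhdsLT hu, hmemT] with s hs hsu hsT
      have hin : ∀ t ∈ Ico s t₀, |t - t₀| < δ ∧ |E t - e₀| < δ ∧ |E t + jump X t - e₀| < δ ∧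
          t ∈ Icc 0 T := fun t ht => hu' ⟨hsu.1.trans_le ht.1, ht.2⟩
      -- At `t₀` itself only `E` is close to the pivot: the value after a jump at `t₀` need not be.
      -- This endpoint enters the `dt`-integrals but not the integral over `Ico s t₀`.
      have hin' : ∀ t ∈ Ioc s t₀, |t - t₀| < δ ∧ |E t - e₀| < δ := fun t ht => by
        rcases ht.2.eq_or_lt with rfl | h
        · simpa [he₀] using hδ
        · exact ⟨(hin t ⟨ht.1.le, h⟩).1, (hin t ⟨ht.1.le, h⟩).2.1⟩
      have hts : s ≤ t₀ := hsu.2.le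
      have hsubI : Ico s t₀ ⊆ Icc 0 T := fun t ht => (hin t ht).2.2.2
      have hcore := abs_increment_sub_integral_le (m := m) (I := Ico s t₀)
        (θ := θ) (u := fun t => Φt (t, E t)) (v := fun t => Φe (t, E t)) (r := r)
        (ce := Φe (t₀, e₀)) (ct := Φt (t₀, e₀)) (ε := ε) (C := C) (ep := E s) (eq := e₀)
        (Φp := Φ (s, E s)) (Φq := Φ (t₀, e₀)) hts (hθs hsubI)
        (fun t ht => by
          obtain ⟨h1, h2, h3, h4⟩ := hin t ht
          exact hθnear h4 h1 h2 h3 hnb)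
        (hui _ hsT _ ht₀') (fun t ht => (hnb t (E t) (hin' t ht).1 (hin' t ht).2).2)
        (hvi _ hsT _ ht₀') (fun t ht => (hnb t (E t) (hin' t ht).1 (hin' t ht).2).1)
        (hr _ _) (fun t _ => hrC t)
        (by
          rw [hm, pathMeasure_Ico hX hl hts,
            ← intervalIntegral.integral_interval_sub_left (hr 0 t₀) (hr 0 s)]
          simp only [he₀, hE, driftPath]; ring)
        hε.le
        (by
          have h1 : ‖(s, E s) - (t₀, e₀)‖ ≤ |t₀ - s| + |e₀ - E s| := by
            rw [Prod.mk_sub_mk, Prod.norm_mk, Real.norm_eq_abs, Real.norm_eq_abs, abs_sub_comm s,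
              abs_sub_comm (E s)]
            exact max_le_add_of_nonneg (abs_nonneg _) (abs_nonneg _)
          rw [Prod.mk_sub_mk, smul_fst_add_smul_snd_apply, ← Prod.mk_sub_mk] at hs
          have h2 := hs.trans (mul_le_mul_of_nonneg_left h1 hε.le)
          rw [← norm_neg] at h2
          refine le_trans (le_of_eq ?_) h2
          rw [Real.norm_eq_abs]
          congr 1; ring)
      rw [hDsub s hsT t₀ ht₀' hts, hVsub s t₀ hts]
      exact hcore
  -- `D T` leaves out the atom at `T`, which supplies the passage from `E_T` to `E_{T+}`.
  have hsplit : (∫ᵛ t in Icc 0 T, θ t ∂•m) =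
      (∫ᵛ t in Ico 0 T, θ t ∂•m) + (Φ (T, E T + jump X T) - Φ (T, E T)) := by
    rw [← hsing, ← VectorMeasure.setIntegral_union (by simp) measurableSet_Ico
      (measurableSet_singleton _) (hθs Ico_subset_Icc_self) (hθs (by simpa using hT)),
      union_singleton, Ico_insert_right hT]
  have hD0 : D 0 = Φ (0, E 0) := by simp [hD]
  rw [hD0] at hmain
  rw [hsplit]
  simp only [hD] at hmain
  linarith

end ChainRule

/-! ### The shape function and its transforms -/

/-- The standing assumptions on the market. -/
structure MarketModel (T : ℝ) (f lam rho : ℝ → ℝ) : Prop where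
  T_pos : 0 < T
  f_contDiff : ContDiff ℝ 1 f
  f_pos : ∀ y, 0 < f y
  F_bot : Tendsto (shapeF f) atBot atBot
  F_top : Tendsto (shapeF f) atTop atTop
  lam_contDiffOn : ContDiffOn ℝ 2 lam (Icc 0 T)
  lam_pos : ∀ t ∈ Icc 0 T, 0 < lam t
  rho_contDiffOn : ContDiffOn ℝ 1 rho (Icc 0 T)
  rho_pos : ∀ t ∈ Icc 0 T, 0 < rho t
  h_bij : ∀ t ∈ Icc 0 T, Function.Bijective (hV T f lam rho t)
  h_deriv : ∀ t ∈ Icc 0 T, ∀ y, 0 < deriv (hV T f lam rho t) y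

/-- `F⁻¹(y) + a y / f(F⁻¹(y))`, which is `h_{V,t}(y)` for `a = (η_t + ρ_t) / ρ_t`. -/
def hCoeff (f : ℝ → ℝ) (a y : ℝ) : ℝ := shapeFInv f y + a * (y / f (shapeFInv f y))

/-- The antiderivative `a y F⁻¹(y) + (1 - a) G(y)` of `hCoeff f a`. -/
def hPrim (f : ℝ → ℝ) (a y : ℝ) : ℝ := a * (y * shapeFInv f y) + (1 - a) * shapeG f y

/-- `(η_t + ρ_t) / ρ_t`. -/
def impactCoeff (T : ℝ) (lam rho : ℝ → ℝ) (t : ℝ) : ℝ := (eta T lam t + rho t) / rho t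

theorem hV_eq_hCoeff (T : ℝ) (f lam rho : ℝ → ℝ) (t : ℝ) :
    hV T f lam rho t = hCoeff f (impactCoeff T lam rho t) := rfl

namespace MarketModel

variable {T : ℝ} {f lam rho : ℝ → ℝ}

theorem hasDerivAt_shapeF (M : MarketModel T f lam rho) (y : ℝ) :
    HasDerivAt (shapeF f) (f y) y :=
  (M.f_contDiff.continuous.integral_hasStrictDerivAt 0 y).hasDerivAt

theorem continuous_shapeF (M : MarketModel T f lam rho) : Continuous (shapeF f) :=
  continuous_iff_continuousAt.2 fun y => (M.hasDerivAt_shapeF y).continuousAt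

theorem strictMono_shapeF (M : MarketModel T f lam rho) : StrictMono (shapeF f) :=
  strictMono_of_deriv_pos fun y => by rw [(M.hasDerivAt_shapeF y).deriv]; exact M.f_pos y

theorem surjective_shapeF (M : MarketModel T f lam rho) : Function.Surjective (shapeF f) :=
  M.continuous_shapeF.surjective M.F_top M.F_bot

theorem shapeF_shapeFInv (M : MarketModel T f lam rho) (y : ℝ) : shapeF f (shapeFInv f y) = y :=
  Function.rightInverse_invFun M.surjective_shapeF y

theorem shapeFInv_shapeF (M : MarketModel T f lam rho) (y : ℝ) : shapeFInv f (shapeF f y) = y :=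
  Function.leftInverse_invFun M.strictMono_shapeF.injective y

theorem strictMono_shapeFInv (M : MarketModel T f lam rho) : StrictMono (shapeFInv f) := by
  intro y z h
  rwa [← M.strictMono_shapeF.lt_iff_lt, M.shapeF_shapeFInv, M.shapeF_shapeFInv]

theorem surjective_shapeFInv (M : MarketModel T f lam rho) : Function.Surjective (shapeFInv f) :=
  fun y => ⟨shapeF f y, M.shapeFInv_shapeF y⟩

theorem continuous_shapeFInv (M : MarketModel T f lam rho) : Continuous (shapeFInv f) :=
  M.strictMono_shapeFInv.monotone.continuous_of_surjective M.surjective_shapeFInv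

theorem shapeF_zero : shapeF f 0 = 0 := by simp [shapeF]

theorem shapeFInv_zero (M : MarketModel T f lam rho) : shapeFInv f 0 = 0 := by
  have := M.shapeFInv_shapeF 0
  rwa [shapeF_zero] at this

theorem hasDerivAt_shapeFInv (M : MarketModel T f lam rho) (y : ℝ) :
    HasDerivAt (shapeFInv f) (f (shapeFInv f y))⁻¹ y :=
  (M.hasDerivAt_shapeF (shapeFInv f y)).of_local_left_inverse M.continuous_shapeFInv.continuousAt
    (M.f_pos _).ne' (Eventually.of_forall M.shapeF_shapeFInv)

theorem contDiff_shapeFInv (M : MarketModel T f lam rho) : ContDiff ℝ 1 (shapeFInv f) := by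
  rw [contDiff_one_iff_deriv]
  refine ⟨fun y => (M.hasDerivAt_shapeFInv y).differentiableAt, ?_⟩
  have : deriv (shapeFInv f) = fun y => (f (shapeFInv f y))⁻¹ :=
    funext fun y => (M.hasDerivAt_shapeFInv y).deriv
  rw [this]
  exact (M.f_contDiff.continuous.comp M.continuous_shapeFInv).inv₀ fun y => (M.f_pos _).ne'

theorem hasDerivAt_shapeFTilde (M : MarketModel T f lam rho) (y : ℝ) :
    HasDerivAt (shapeFTilde f) (y * f y) y :=
  ((continuous_id.mul M.f_contDiff.continuous).integral_hasStrictDerivAt 0 y).hasDerivAt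

/-- The density `f` in the derivative of `F̃` cancels the derivative `1 / f` of `F⁻¹`. As `F⁻¹` is
increasing, `G` is convex. -/
theorem hasDerivAt_shapeG (M : MarketModel T f lam rho) (y : ℝ) :
    HasDerivAt (shapeG f) (shapeFInv f y) y := by
  have h := (M.hasDerivAt_shapeFTilde (shapeFInv f y)).comp y (M.hasDerivAt_shapeFInv y)
  refine h.congr_deriv ?_
  have := (M.f_pos (shapeFInv f y)).ne'
  field_simp

theorem continuous_shapeG (M : MarketModel T f lam rho) : Continuous (shapeG f) :=
  continuous_iff_continuousAt.2 fun y => (M.hasDerivAt_shapeG y).continuousAt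

theorem shapeG_zero (M : MarketModel T f lam rho) : shapeG f 0 = 0 := by
  simp [shapeG, M.shapeFInv_zero, shapeFTilde]

theorem hCoeff_zero (M : MarketModel T f lam rho) (a : ℝ) : hCoeff f a 0 = 0 := by
  simp [hCoeff, M.shapeFInv_zero]

theorem hPrim_zero (M : MarketModel T f lam rho) (a : ℝ) : hPrim f a 0 = 0 := by
  simp [hPrim, M.shapeG_zero]

/-- The multiples `a` and `1 - a` of `F⁻¹` add up to one. Through this identity the monotonicity of
`h_{V,t}` becomes convexity of the running cost. -/
theorem hasDerivAt_hPrim (M : MarketModel T f lam rho) (a y : ℝ) :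
    HasDerivAt (hPrim f a) (hCoeff f a y) y := by
  have h := (((hasDerivAt_id y).mul (M.hasDerivAt_shapeFInv y)).const_mul a).add
    ((M.hasDerivAt_shapeG y).const_mul (1 - a))
  refine h.congr_deriv ?_
  simp only [hCoeff, id, div_eq_mul_inv]
  ring

theorem continuous_hPrim (M : MarketModel T f lam rho) :
    Continuous fun p : ℝ × ℝ => hPrim f p.1 p.2 := by
  have h1 := M.continuous_shapeFInv
  have h2 := M.continuous_shapeG
  unfold hPrim
  fun_prop

theorem contDiff_hCoeff (M : MarketModel T f lam rho) :
    ContDiff ℝ 1 fun p : ℝ × ℝ => hCoeff f p.1 p.2 := by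
  have h1 : ContDiff ℝ 1 fun p : ℝ × ℝ => shapeFInv f p.2 := M.contDiff_shapeFInv.comp contDiff_snd
  exact h1.add (contDiff_fst.mul (contDiff_snd.div (M.f_contDiff.comp h1) fun p => (M.f_pos _).ne'))

/-! ### The functions `h_{V,t}` and their inverses -/

theorem zero_mem (M : MarketModel T f lam rho) : (0 : ℝ) ∈ Icc 0 T := ⟨le_rfl, M.T_pos.le⟩

theorem T_mem (M : MarketModel T f lam rho) : T ∈ Icc 0 T := ⟨M.T_pos.le, le_rfl⟩

theorem uniqueDiffOn (M : MarketModel T f lam rho) : UniqueDiffOn ℝ (Icc 0 T) :=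
  uniqueDiffOn_Icc M.T_pos

theorem contDiffOn_derivWithin_lam (M : MarketModel T f lam rho) :
    ContDiffOn ℝ 1 (derivWithin lam (Icc 0 T)) (Icc 0 T) :=
  M.lam_contDiffOn.derivWithin M.uniqueDiffOn (by norm_num)

theorem hasDerivWithinAt_lam (M : MarketModel T f lam rho) {t : ℝ} (ht : t ∈ Icc 0 T) :
    HasDerivWithinAt lam (derivWithin lam (Icc 0 T) t) (Icc 0 T) t :=
  ((M.lam_contDiffOn.differentiableOn (by norm_num)) t ht).hasDerivWithinAt

theorem contDiffOn_eta (M : MarketModel T f lam rho) : ContDiffOn ℝ 1 (eta T lam) (Icc 0 T) :=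
  M.contDiffOn_derivWithin_lam.div (M.lam_contDiffOn.of_le (by norm_num))
    fun t ht => (M.lam_pos t ht).ne'

theorem contDiffOn_impactCoeff (M : MarketModel T f lam rho) :
    ContDiffOn ℝ 1 (impactCoeff T lam rho) (Icc 0 T) :=
  (M.contDiffOn_eta.add M.rho_contDiffOn).div M.rho_contDiffOn fun t ht => (M.rho_pos t ht).ne'

theorem strictMono_hV (M : MarketModel T f lam rho) {t : ℝ} (ht : t ∈ Icc 0 T) :
    StrictMono (hV T f lam rho t) := strictMono_of_deriv_pos (M.h_deriv t ht)

theorem strictMono_hCoeff (M : MarketModel T f lam rho) {t : ℝ} (ht : t ∈ Icc 0 T) :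
    StrictMono (hCoeff f (impactCoeff T lam rho t)) := M.strictMono_hV ht

theorem hV_hVInv (M : MarketModel T f lam rho) {t : ℝ} (ht : t ∈ Icc 0 T) (nu : ℝ) :
    hV T f lam rho t (hVInv T f lam rho t nu) = nu :=
  Function.rightInverse_invFun (M.h_bij t ht).2 nu

theorem hVInv_eq_iff (M : MarketModel T f lam rho) {t : ℝ} (ht : t ∈ Icc 0 T) {nu y : ℝ} :
    hVInv T f lam rho t nu = y ↔ hV T f lam rho t y = nu := by
  constructor
  · rintro rfl; exact M.hV_hVInv ht nu
  · rintro rfl; exact Function.leftInverse_invFun (M.h_bij t ht).1 y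

theorem strictMono_hVInv (M : MarketModel T f lam rho) {t : ℝ} (ht : t ∈ Icc 0 T) :
    StrictMono (hVInv T f lam rho t) := by
  intro y z h
  rwa [← (M.strictMono_hV ht).lt_iff_lt, M.hV_hVInv ht, M.hV_hVInv ht]

theorem hVInv_zero (M : MarketModel T f lam rho) {t : ℝ} (ht : t ∈ Icc 0 T) :
    hVInv T f lam rho t 0 = 0 := by
  rw [M.hVInv_eq_iff ht, hV_eq_hCoeff, M.hCoeff_zero]

/-- The inverse function theorem is applied to `(a, y) ↦ (a, hCoeff f a y)`, with the coefficient
`a` as parameter instead of `t`: this map is `C¹` on the whole plane, whereas the time dependence is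
`C¹` only within the closed interval `[0, T]`. Composing with `t ↦ a_t` comes last. -/
theorem contDiffOn_hVInv (M : MarketModel T f lam rho) :
    ContDiffOn ℝ 1 (fun p : ℝ × ℝ => hVInv T f lam rho p.1 p.2) (Icc 0 T ×ˢ univ) := by
  rintro ⟨t₀, nu₀⟩ ⟨ht₀, -⟩
  set α := impactCoeff T lam rho with hα
  set y₀ := hVInv T f lam rho t₀ nu₀ with hy₀
  set Ψ : ℝ × ℝ → ℝ × ℝ := fun p => (p.1, hCoeff f p.1 p.2) with hΨ
  have hΨc : ContDiff ℝ 1 Ψ := contDiff_fst.prodMk M.contDiff_hCoeff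
  set Lk := fderiv ℝ (fun p : ℝ × ℝ => hCoeff f p.1 p.2) (α t₀, y₀) with hLk
  have hLkd : HasFDerivAt (fun p : ℝ × ℝ => hCoeff f p.1 p.2) Lk (α t₀, y₀) :=
    (M.contDiff_hCoeff.differentiable (by norm_num) _).hasFDerivAt
  set b := Lk (1, 0) with hb
  set d := Lk (0, 1) with hd
  have hLkeq : ∀ u w, Lk (u, w) = u * b + w * d := by
    intro u w
    have : ((u, w) : ℝ × ℝ) = u • (1, 0) + w • (0, 1) := by simp
    rw [this, map_add, map_smul, map_smul, smul_eq_mul, smul_eq_mul]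
  have hdpos : 0 < d := by
    have h1 : HasDerivAt (fun y => hCoeff f (α t₀) y) d y₀ := by
      have h2 : HasDerivAt (fun y : ℝ => ((α t₀, y) : ℝ × ℝ)) (0, 1) y₀ :=
        (hasDerivAt_const y₀ (α t₀)).prodMk (hasDerivAt_id y₀)
      exact hLkd.comp_hasDerivAt y₀ h2
    have := M.h_deriv t₀ ht₀ y₀
    rwa [hV_eq_hCoeff, show deriv (hCoeff f (impactCoeff T lam rho t₀)) y₀ = d from h1.deriv] at this
  -- The derivative `(u, w) ↦ (u, b u + d w)` is triangular, and invertible since `d` is the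
  -- derivative of `h_{V,t₀}`.
  let L : (ℝ × ℝ) ≃L[ℝ] (ℝ × ℝ) := ContinuousLinearEquiv.equivOfInverse
    ((ContinuousLinearMap.fst ℝ ℝ ℝ).prod Lk)
    ((ContinuousLinearMap.fst ℝ ℝ ℝ).prod
      (d⁻¹ • (ContinuousLinearMap.snd ℝ ℝ ℝ - b • ContinuousLinearMap.fst ℝ ℝ ℝ)))
    (by
      rintro ⟨u, w⟩
      simp only [ContinuousLinearMap.prod_apply, ContinuousLinearMap.coe_fst', hLkeq,
        _root_.smul_apply, _root_.sub_apply,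
        ContinuousLinearMap.coe_snd', smul_eq_mul, Prod.mk.injEq, true_and]
      field_simp; ring)
    (by
      rintro ⟨u, w⟩
      simp only [ContinuousLinearMap.prod_apply, ContinuousLinearMap.coe_fst', hLkeq,
        _root_.smul_apply, _root_.sub_apply,
        ContinuousLinearMap.coe_snd', smul_eq_mul, Prod.mk.injEq, true_and]
      field_simp; ring)
  have hL : HasFDerivAt Ψ (L : (ℝ × ℝ) →L[ℝ] (ℝ × ℝ)) (α t₀, y₀) :=
    hasFDerivAt_fst.prodMk hLkd
  have hΨat : ContDiffAt ℝ 1 Ψ (α t₀, y₀) := hΨc.contDiffAt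
  have hΨ₀ : Ψ (α t₀, y₀) = (α t₀, nu₀) := by
    simp only [hΨ, Prod.mk.injEq, true_and]
    exact M.hV_hVInv ht₀ nu₀
  have hinv := hΨat.to_localInverse hL (by norm_num)
  set φ := hΨat.localInverse hL (by norm_num) with hφ
  have hright : ∀ᶠ q in 𝓝 (α t₀, nu₀), Ψ (φ q) = q := by
    rw [← hΨ₀]
    exact (hΨat.hasStrictFDerivAt' hL (by norm_num)).eventually_right_inverse
  rw [hΨ₀] at hinv
  have hin : ContDiffWithinAt ℝ 1 (fun p : ℝ × ℝ => (α p.1, p.2)) (Icc 0 T ×ˢ univ) (t₀, nu₀) :=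
    ((M.contDiffOn_impactCoeff t₀ ht₀).comp (t₀, nu₀) contDiffWithinAt_fst
      (fun p hp => hp.1)).prodMk contDiffWithinAt_snd
  have hcomp : ContDiffWithinAt ℝ 1 (fun p : ℝ × ℝ => (φ (α p.1, p.2)).2) (Icc 0 T ×ˢ univ)
      (t₀, nu₀) := contDiffAt_snd.comp_contDiffWithinAt (t₀, nu₀)
    (ContDiffAt.comp_contDiffWithinAt (t₀, nu₀)
      (f := fun p : ℝ × ℝ => (α p.1, p.2)) (show ContDiffAt ℝ 1 φ (α t₀, nu₀) from hinv) hin)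
  -- The local inverse solves the defining equation of the global inverse, whose solution is unique
  -- by bijectivity of `h_{V,t}`.
  have hev : ∀ᶠ p : ℝ × ℝ in 𝓝[Icc 0 T ×ˢ univ] (t₀, nu₀),
      hVInv T f lam rho p.1 p.2 = (φ (α p.1, p.2)).2 := by
    filter_upwards [hin.continuousWithinAt.tendsto.eventually hright, self_mem_nhdsWithin]
      with p hp hpS
    rw [M.hVInv_eq_iff hpS.1, hV_eq_hCoeff]
    simp only [hΨ, Prod.mk.injEq] at hp
    have h2 := hp.2
    rw [hp.1] at h2
    exact h2
  exact hcomp.congr_of_eventuallyEq_of_mem hev ⟨ht₀, mem_univ _⟩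

theorem contDiffOn_zeta (M : MarketModel T f lam rho) (nu : ℝ) :
    ContDiffOn ℝ 1 (zeta T f lam rho nu) (Icc 0 T) :=
  M.contDiffOn_hVInv.comp (contDiffOn_id.prodMk contDiffOn_const)
    fun _ ht => ⟨ht, mem_univ _⟩

theorem continuousOn_tradingRate (M : MarketModel T f lam rho) (nu : ℝ) :
    ContinuousOn (tradingRate T f lam rho nu) (Icc 0 T) := by
  have h1 := (M.contDiffOn_zeta nu).continuousOn_derivWithin M.uniqueDiffOn le_rfl
  exact M.lam_contDiffOn.continuousOn.mul (h1.add
    ((M.rho_contDiffOn.continuousOn.add M.contDiffOn_eta.continuousOn).mul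
      (M.contDiffOn_zeta nu).continuousOn))

/-! ### The equation for the multiplier -/

/-- The left-hand side of the equation for the multiplier `ν`. -/
def multiplierFun (T : ℝ) (f lam rho : ℝ → ℝ) (nu : ℝ) : ℝ :=
  (∫ t in (0 : ℝ)..T, lam t * rho t * hVInv T f lam rho t nu) + lam T * shapeF f nu

theorem continuousOn_integrand (M : MarketModel T f lam rho) (nu : ℝ) :
    ContinuousOn (fun t => lam t * rho t * hVInv T f lam rho t nu) (Icc 0 T) :=
  (M.lam_contDiffOn.continuousOn.mul M.rho_contDiffOn.continuousOn).mul
    (M.contDiffOn_zeta nu).continuousOn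

theorem intervalIntegrable_integrand (M : MarketModel T f lam rho) (nu : ℝ) :
    IntervalIntegrable (fun t => lam t * rho t * hVInv T f lam rho t nu) volume 0 T :=
  ContinuousOn.intervalIntegrable (by
    rw [uIcc_of_le M.T_pos.le]; exact M.continuousOn_integrand nu)

/-- Strictness is supplied by the term `λ(T) F(ν)`; the integral need only be monotone. -/
theorem strictMono_multiplierFun (M : MarketModel T f lam rho) :
    StrictMono (multiplierFun T f lam rho) := by
  intro y z h
  refine add_lt_add_of_le_of_lt ?_ ?_
  · refine intervalIntegral.integral_mono_on M.T_pos.le (M.intervalIntegrable_integrand y)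
      (M.intervalIntegrable_integrand z) fun t ht => ?_
    exact mul_le_mul_of_nonneg_left ((M.strictMono_hVInv ht) h).le
      (mul_pos (M.lam_pos t ht) (M.rho_pos t ht)).le
  · exact mul_lt_mul_of_pos_left (M.strictMono_shapeF h) (M.lam_pos T M.T_mem)

theorem multiplierFun_zero (M : MarketModel T f lam rho) : multiplierFun T f lam rho 0 = 0 := by
  have : ∫ t in (0 : ℝ)..T, lam t * rho t * hVInv T f lam rho t 0 = 0 := by
    rw [intervalIntegral.integral_congr (g := fun _ => 0)]
    · simp
    · intro t ht
      rw [uIcc_of_le M.T_pos.le] at ht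
      simp [M.hVInv_zero ht]
  rw [multiplierFun, this, shapeF_zero]
  simp

theorem continuous_multiplierFun (M : MarketModel T f lam rho) :
    Continuous (multiplierFun T f lam rho) := by
  refine Continuous.add ?_ (continuous_const.mul M.continuous_shapeF)
  -- The data are regular only on `[0, T]`; projecting time onto this interval makes the integrand
  -- jointly continuous without changing the integral.
  have hp : Continuous fun t : ℝ => (projIcc 0 T M.T_pos.le t : ℝ) :=
    continuous_subtype_val.comp continuous_projIcc
  have hpm : ∀ t, (projIcc 0 T M.T_pos.le t : ℝ) ∈ Icc 0 T := fun t => (projIcc 0 T _ t).2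
  have hcont : Continuous (Function.uncurry fun (nu t : ℝ) =>
      lam (projIcc 0 T M.T_pos.le t) * rho (projIcc 0 T M.T_pos.le t) *
        hVInv T f lam rho (projIcc 0 T M.T_pos.le t) nu) := by
    refine Continuous.mul (Continuous.mul ?_ ?_) ?_
    · exact M.lam_contDiffOn.continuousOn.comp_continuous (hp.comp continuous_snd) fun p => hpm _
    · exact M.rho_contDiffOn.continuousOn.comp_continuous (hp.comp continuous_snd) fun p => hpm _
    · exact M.contDiffOn_hVInv.continuousOn.comp_continuous
        ((hp.comp continuous_snd).prodMk continuous_fst) fun p => ⟨hpm _, mem_univ _⟩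
  have h := intervalIntegral.continuous_parametric_intervalIntegral_of_continuous' (μ := volume)
    hcont 0 T
  refine h.congr fun nu => intervalIntegral.integral_congr fun t ht => ?_
  rw [uIcc_of_le M.T_pos.le] at ht
  simp only [projIcc_of_mem M.T_pos.le ht]

theorem surjective_multiplierFun (M : MarketModel T f lam rho) :
    Function.Surjective (multiplierFun T f lam rho) := by
  have hT := M.lam_pos T M.T_mem
  refine M.continuous_multiplierFun.surjective ?_ ?_
  -- For `ν ≥ 0` the integral is nonnegative because `h_{V,t}⁻¹` is increasing and vanishes at `0`,
  -- so `λ(T) F(ν)` is a lower bound; symmetrically at `-∞`.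
  · refine tendsto_atTop_mono' _ ?_ (M.F_top.const_mul_atTop hT)
    filter_upwards [eventually_ge_atTop 0] with nu hnu
    refine le_add_of_nonneg_left (intervalIntegral.integral_nonneg M.T_pos.le fun t ht => ?_)
    refine mul_nonneg (mul_pos (M.lam_pos t ht) (M.rho_pos t ht)).le ?_
    rw [← M.hVInv_zero ht]
    exact (M.strictMono_hVInv ht).monotone hnu
  · refine tendsto_atBot_mono' _ ?_ (M.F_bot.const_mul_atBot hT)
    filter_upwards [eventually_le_atBot 0] with nu hnu
    refine add_le_of_nonpos_left ?_
    rw [← neg_nonneg, ← intervalIntegral.integral_neg]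
    refine intervalIntegral.integral_nonneg M.T_pos.le fun t ht => ?_
    rw [← mul_neg]
    refine mul_nonneg (mul_pos (M.lam_pos t ht) (M.rho_pos t ht)).le (neg_nonneg.2 ?_)
    rw [← M.hVInv_zero ht]
    exact (M.strictMono_hVInv ht).monotone hnu

theorem existsUnique_multiplierEq (M : MarketModel T f lam rho) (x : ℝ) :
    ∃! nu, MultiplierEq T x f lam rho nu := by
  obtain ⟨nu, hnu⟩ := M.surjective_multiplierFun (-x)
  exact ⟨nu, hnu, fun nu' h' => M.strictMono_multiplierFun.injective (h'.trans hnu.symm)⟩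

theorem sign_eq_of_strictMono {g : ℝ → ℝ} (hg : StrictMono g) (h0 : g 0 = 0) (y : ℝ) :
    SignType.sign (g y) = SignType.sign y := by
  rcases lt_trichotomy y 0 with h | rfl | h
  · rw [sign_neg h, sign_neg (by rw [← h0]; exact hg h)]
  · rw [h0]
  · rw [sign_pos h, sign_pos (by rw [← h0]; exact hg h)]

/-- The maps `ν ↦ -x` and `ν ↦ ζ_0` are both strictly increasing and vanish at `0`, so `-x`, `ν` and
`ζ_0` share their sign. -/
theorem sign_initialTrade (M : MarketModel T f lam rho) {x nu : ℝ}
    (hnu : MultiplierEq T x f lam rho nu) :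
    SignType.sign (initialTrade T f lam rho nu) = SignType.sign (-x) := by
  have h1 : multiplierFun T f lam rho nu = -x := hnu
  rw [← h1, sign_eq_of_strictMono M.strictMono_multiplierFun M.multiplierFun_zero, initialTrade,
    sign_mul, sign_pos (M.lam_pos 0 M.zero_mem), one_mul]
  exact sign_eq_of_strictMono (M.strictMono_hVInv M.zero_mem) (M.hVInv_zero M.zero_mem) nu

end MarketModel

/-! ### The volume impact process -/

/-- The integral of a function with respect to a signed measure over a countable set. -/
theorem hasSum_setIntegral_of_countable {m : SignedMeasure ℝ} {g : ℝ → ℝ} {S : Set ℝ}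
    (hS : S.Countable) (hg : m.IntegrableOn g S) :
    HasSum (fun t : S => g t * m {(t : ℝ)}) (∫ᵛ t in S, g t ∂•m) := by
  have : Countable S := hS.to_subtype
  have hind : ∀ t : S, (∫ᵛ s, indicator {(t : ℝ)} g s ∂•m) = g t * m {(t : ℝ)} := by
    intro t
    rw [VectorMeasure.integral_indicator (measurableSet_singleton _),
      VectorMeasure.integral_singleton]
    simp
  have hone : ∀ a, HasSum (fun t : S => indicator {(t : ℝ)} g a) (indicator S g a) := by
    intro a
    by_cases ha : a ∈ S
    · have h := hasSum_single (f := fun t : S => indicator {(t : ℝ)} g a) ⟨a, ha⟩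
        (fun t ht => indicator_of_notMem (fun h => ht (Subtype.ext h.symm)) _)
      rwa [indicator_of_mem (mem_singleton a), ← indicator_of_mem ha g] at h
    · rw [indicator_of_notMem ha]
      convert! hasSum_zero with t
      exact indicator_of_notMem (fun h => ha (by rw [mem_singleton_iff.1 h]; exact t.2)) _
  have hone' : ∀ a, HasSum (fun t : S => ‖indicator {(t : ℝ)} g a‖) ‖indicator S g a‖ := by
    intro a
    by_cases ha : a ∈ S
    · have h := hasSum_single (f := fun t : S => ‖indicator {(t : ℝ)} g a‖) ⟨a, ha⟩
        (fun t ht => by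
          rw [indicator_of_notMem (fun h => ht (Subtype.ext h.symm)), norm_zero])
      rwa [indicator_of_mem (mem_singleton a), ← indicator_of_mem ha g] at h
    · rw [indicator_of_notMem ha, norm_zero]
      convert! hasSum_zero with t
      rw [indicator_of_notMem (fun h => ha (by rw [mem_singleton_iff.1 h]; exact t.2)), norm_zero]
  -- At each point at most one of the indicators is nonzero, so the absolute values sum to `|1_S
  -- g|`, which is integrable and dominates.
  have h : HasSum (fun t : S => ∫ᵛ s, indicator {(t : ℝ)} g s ∂•m) (∫ᵛ s, indicator S g s ∂•m) :=
    VectorMeasure.hasSum_integral_of_dominated_convergence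
    (fun (t : S) a => ‖indicator {(t : ℝ)} g a‖)
    (fun t => by
      have : indicator {(t : ℝ)} g = indicator {(t : ℝ)} fun _ => g t := by
        ext a
        by_cases ha : a = (t : ℝ)
        · simp [ha]
        · simp [ha]
      rw [this]
      exact (measurable_const.indicator (measurableSet_singleton _)).aestronglyMeasurable)
    (fun t => Eventually.of_forall fun a => le_rfl)
    (Eventually.of_forall fun a => (hone' a).summable)
    (by
      simp_rw [fun a => (hone' a).tsum_eq]
      exact (hg.integrable_indicator hS.measurableSet).norm)
    (Eventually.of_forall hone)
  simp_rw [hind] at h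
  rwa [VectorMeasure.integral_indicator hS.measurableSet] at h

/-- The extension of `rho` from `[0, T]` to the line by constants. -/
def extendRate {T : ℝ} (hT : 0 ≤ T) (rho : ℝ → ℝ) (t : ℝ) : ℝ := rho (projIcc 0 T hT t)

theorem extendRate_of_mem {T : ℝ} (hT : 0 ≤ T) (rho : ℝ → ℝ) {t : ℝ} (ht : t ∈ Icc 0 T) :
    extendRate hT rho t = rho t := by rw [extendRate, projIcc_of_mem hT ht]

theorem continuous_extendRate {T : ℝ} (hT : 0 ≤ T) {rho : ℝ → ℝ}
    (hrho : ContinuousOn rho (Icc 0 T)) : Continuous (extendRate hT rho) :=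
  hrho.comp_continuous (continuous_subtype_val.comp continuous_projIcc) fun t =>
    (projIcc 0 T hT t).2

/-- `∫₀ᵗ ρ_s ds`. -/
def rateIntegral {T : ℝ} (hT : 0 ≤ T) (rho : ℝ → ℝ) (t : ℝ) : ℝ :=
  ∫ s in (0 : ℝ)..t, extendRate hT rho s

theorem continuous_rateIntegral {T : ℝ} (hT : 0 ≤ T) {rho : ℝ → ℝ}
    (hrho : ContinuousOn rho (Icc 0 T)) : Continuous (rateIntegral hT rho) :=
  intervalIntegral.continuous_primitive
    (fun _ _ => (continuous_extendRate hT hrho).intervalIntegrable _ _) 0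

/-- The kernel `ρ_s exp (∫₀ˢ ρ)`. -/
def rateKernel {T : ℝ} (hT : 0 ≤ T) (rho : ℝ → ℝ) (s : ℝ) : ℝ :=
  extendRate hT rho s * Real.exp (rateIntegral hT rho s)

theorem continuous_rateKernel {T : ℝ} (hT : 0 ≤ T) {rho : ℝ → ℝ}
    (hrho : ContinuousOn rho (Icc 0 T)) : Continuous (rateKernel hT rho) :=
  (continuous_extendRate hT hrho).mul (Real.continuous_exp.comp (continuous_rateIntegral hT hrho))

/-- The exponential kernel is factored so that `t` appears only outside the integral and in its
upper limit; bounds and measurability of `E` can be read off from this form. -/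
theorem volumeImpact_eq_exp {T : ℝ} (hT : 0 ≤ T) {rho : ℝ → ℝ}
    (hrho : ContinuousOn rho (Icc 0 T)) (X : ℝ → ℝ) {t : ℝ} (ht : t ∈ Icc 0 T) :
    volumeImpact rho X t = X t - X 0 - Real.exp (-rateIntegral hT rho t) *
      ∫ s in (0 : ℝ)..t, rateKernel hT rho s * (X s - X 0) := by
  rw [volumeImpact, ← intervalIntegral.integral_const_mul]
  congr 1
  refine intervalIntegral.integral_congr fun s hs => ?_
  rw [uIcc_of_le ht.1] at hs
  have h1 : ∫ u in s..t, rho u = rateIntegral hT rho t - rateIntegral hT rho s := by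
    rw [rateIntegral, rateIntegral, intervalIntegral.integral_interval_sub_left
      ((continuous_extendRate hT hrho).intervalIntegrable _ _)
      ((continuous_extendRate hT hrho).intervalIntegrable _ _)]
    refine intervalIntegral.integral_congr fun u hu => ?_
    rw [uIcc_of_le hs.2] at hu
    exact (extendRate_of_mem hT rho ⟨hs.1.trans hu.1, hu.2.trans ht.2⟩).symm
  simp only [h1, rateKernel, extendRate_of_mem hT rho ⟨hs.1, hs.2.trans ht.2⟩]
  rw [show -(rateIntegral hT rho t - rateIntegral hT rho s) =
    -rateIntegral hT rho t + rateIntegral hT rho s by ring, Real.exp_add]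
  ring

/-- The constant does not depend on the path, so that a bound uniform in `ω` on a random strategy
passes to its impact. -/
theorem exists_bound_volumeImpact {T : ℝ} (hT : 0 ≤ T) {rho : ℝ → ℝ}
    (hrho : ContinuousOn rho (Icc 0 T)) :
    ∃ A : ℝ, ∀ (X : ℝ → ℝ) (K : ℝ), (∀ t, |X t - X 0| ≤ K) →
      ∀ t ∈ Icc 0 T, |volumeImpact rho X t| ≤ A * K := by
  obtain ⟨A, hA⟩ := isCompact_Icc.exists_bound_of_continuousOn
    (Real.continuous_exp.comp (continuous_rateIntegral hT hrho).neg).continuousOn (s := Icc 0 T)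
  obtain ⟨B, hB⟩ := isCompact_Icc.exists_bound_of_continuousOn
    (continuous_rateKernel hT hrho).continuousOn (s := Icc 0 T)
  have h0 : (0 : ℝ) ∈ Icc 0 T := ⟨le_rfl, hT⟩
  have hA0 : 0 ≤ A := (norm_nonneg _).trans (hA 0 h0)
  have hB0 : 0 ≤ B := (norm_nonneg _).trans (hB 0 h0)
  refine ⟨1 + A * (B * T), fun X K hK t ht => ?_⟩
  have hK0 : 0 ≤ K := (abs_nonneg _).trans (hK 0)
  rw [volumeImpact_eq_exp hT hrho X ht]
  refine (abs_sub _ _).trans ?_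
  rw [add_mul, one_mul, abs_mul, mul_assoc]
  refine add_le_add (hK t) (mul_le_mul (hA t ht) ?_ (abs_nonneg _) hA0)
  have h1 := intervalIntegral.norm_integral_le_of_norm_le_const (a := 0) (b := t)
    (f := fun s => rateKernel hT rho s * (X s - X 0)) (C := B * K) (fun s hs => by
      rw [uIoc_of_le ht.1] at hs
      rw [norm_mul]
      exact mul_le_mul (hB s ⟨hs.1.le, hs.2.trans ht.2⟩) (hK s) (norm_nonneg _) hB0)
  rw [sub_zero, abs_of_nonneg ht.1] at h1
  refine h1.trans ?_
  have : B * K * t ≤ B * K * T := mul_le_mul_of_nonneg_left ht.2 (mul_nonneg hB0 hK0)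
  linarith

theorem exists_bound_of_boundedVariationOn {X : ℝ → ℝ} (hX : BoundedVariationOn X univ) :
    ∃ K : ℝ, ∀ t, |X t - X 0| ≤ K :=
  ⟨(eVariationOn X univ).toNNReal, fun t =>
    abs_sub_le_of_eVariationOn_le (ENNReal.coe_toNNReal hX).ge t 0⟩

theorem aestronglyMeasurable_volumeImpact {T : ℝ} (hT : 0 ≤ T) {rho X : ℝ → ℝ}
    (hrho : ContinuousOn rho (Icc 0 T)) (hX : BoundedVariationOn X univ) :
    AEStronglyMeasurable (volumeImpact rho X) (volume.restrict (Icc 0 T)) := by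
  have hY : ∀ a b, IntervalIntegrable (fun s => X s - X 0) volume a b := by
    intro a b
    obtain ⟨p, q, hp, hq, rfl⟩ := exists_monotone_sub hX
    exact (hp.intervalIntegrable.sub hq.intervalIntegrable).sub intervalIntegrable_const
  have h1 : Continuous fun t => ∫ s in (0 : ℝ)..t, rateKernel hT rho s * (X s - X 0) :=
    intervalIntegral.continuous_primitive
      (fun a b => (hY a b).continuousOn_mul (continuous_rateKernel hT hrho).continuousOn) 0
  have h2 : Measurable fun t => X t - X 0 - Real.exp (-rateIntegral hT rho t) *
      ∫ s in (0 : ℝ)..t, rateKernel hT rho s * (X s - X 0) :=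
    ((measurable_of_boundedVariationOn hX).sub_const _).sub
      ((Real.continuous_exp.comp (continuous_rateIntegral hT hrho).neg).mul h1).measurable
  refine h2.aestronglyMeasurable.congr ?_
  filter_upwards [ae_restrict_mem measurableSet_Icc] with t ht
  rw [volumeImpact_eq_exp hT hrho X ht]

/-- The drift `ρ_t E_t` of the volume impact process. -/
def impactDrift (T : ℝ) (rho X : ℝ → ℝ) : ℝ → ℝ :=
  indicator (Icc 0 T) fun s => rho s * volumeImpact rho X s

theorem exists_bound_impactDrift {T : ℝ} (hT : 0 ≤ T) {rho X : ℝ → ℝ}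
    (hrho : ContinuousOn rho (Icc 0 T)) (hX : BoundedVariationOn X univ) :
    ∃ C, ∀ t, |impactDrift T rho X t| ≤ C := by
  obtain ⟨A, hA⟩ := exists_bound_volumeImpact hT hrho
  obtain ⟨K, hK⟩ := exists_bound_of_boundedVariationOn hX
  obtain ⟨R, hR⟩ := isCompact_Icc.exists_bound_of_continuousOn hrho
  have h0 : (0 : ℝ) ∈ Icc 0 T := ⟨le_rfl, hT⟩
  have hR0 : 0 ≤ R := (norm_nonneg _).trans (hR 0 h0)
  have hC0 : 0 ≤ R * (A * K) := mul_nonneg hR0 ((abs_nonneg _).trans (hA X K hK 0 h0))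
  refine ⟨R * (A * K), fun t => ?_⟩
  by_cases ht : t ∈ Icc 0 T
  · rw [impactDrift, indicator_of_mem ht, abs_mul]
    exact mul_le_mul (hR t ht) (hA X K hK t ht) (abs_nonneg _) hR0
  · rw [impactDrift, indicator_of_notMem ht, abs_zero]
    exact hC0

theorem intervalIntegrable_impactDrift {T : ℝ} (hT : 0 ≤ T) {rho X : ℝ → ℝ}
    (hrho : ContinuousOn rho (Icc 0 T)) (hX : BoundedVariationOn X univ) (a b : ℝ) :
    IntervalIntegrable (impactDrift T rho X) volume a b := by
  obtain ⟨C, hC⟩ := exists_bound_impactDrift hT hrho hX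
  have hm : AEStronglyMeasurable (impactDrift T rho X) volume := by
    rw [impactDrift, aestronglyMeasurable_indicator_iff measurableSet_Icc]
    exact (hrho.aestronglyMeasurable measurableSet_Icc).mul
      (aestronglyMeasurable_volumeImpact hT hrho hX)
  rw [intervalIntegrable_iff]
  exact Measure.integrableOn_of_bounded (by simp) hm (M := C) (Eventually.of_forall hC)

theorem integral_impactDrift {T : ℝ} (rho X : ℝ → ℝ) {t : ℝ} (ht : t ∈ Icc 0 T) :
    ∫ s in (0 : ℝ)..t, impactDrift T rho X s = ∫ s in (0 : ℝ)..t, rho s * volumeImpact rho X s := by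
  refine intervalIntegral.integral_congr fun s hs => ?_
  rw [uIcc_of_le ht.1] at hs
  have hs' : s ∈ Icc 0 T := ⟨hs.1, hs.2.trans ht.2⟩
  simp only [impactDrift, indicator_of_mem hs']

theorem volumeImpact_eq_driftPath {T : ℝ} {rho X : ℝ → ℝ}
    (hrho : ContinuousOn rho (Icc 0 T)) (hX : BoundedVariationOn X univ) {t : ℝ}
    (ht : t ∈ Icc 0 T) : volumeImpact rho X t = driftPath X (impactDrift T rho X) t := by
  rw [volumeImpact_eq hrho hX ht, driftPath, integral_impactDrift rho X ht]

/-! ### The cost as a function of the volume impact -/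

/-- The cost of a strategy expressed through its volume impact `e`. -/
def reducedCost (T x : ℝ) (f lam rho e : ℝ → ℝ) : ℝ :=
  lam T * shapeG f ((-x - ∫ s in (0 : ℝ)..T, rho s * e s) / lam T) +
    ∫ t in (0 : ℝ)..T, lam t * rho t * hPrim f (impactCoeff T lam rho t) (e t / lam t)

/-- `λ(t) G(e / λ(t))`, the cost of a block trade building up the impact `e` at time `t`. -/
def blockCost (f lam : ℝ → ℝ) (p : ℝ × ℝ) : ℝ := lam p.1 * shapeG f (p.2 / lam p.1)

namespace MarketModel

variable {T : ℝ} {f lam rho : ℝ → ℝ}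

/-- The time derivative of `blockCost`. -/
def blockCostTime (hT : 0 ≤ T) (f lam : ℝ → ℝ) (p : ℝ × ℝ) : ℝ :=
  extendRate hT (derivWithin lam (Icc 0 T)) p.1 *
    (shapeG f (p.2 / extendRate hT lam p.1) -
      p.2 / extendRate hT lam p.1 * shapeFInv f (p.2 / extendRate hT lam p.1))

/-- The derivative of `blockCost` with respect to the impact. -/
def blockCostImpact (hT : 0 ≤ T) (f lam : ℝ → ℝ) (p : ℝ × ℝ) : ℝ :=
  shapeFInv f (p.2 / extendRate hT lam p.1)

theorem continuous_div_extendRate (M : MarketModel T f lam rho) :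
    Continuous fun p : ℝ × ℝ => p.2 / extendRate M.T_pos.le lam p.1 :=
  continuous_snd.div ((continuous_extendRate _ M.lam_contDiffOn.continuousOn).comp continuous_fst)
    fun p => (M.lam_pos _ (projIcc 0 T M.T_pos.le p.1).2).ne'

theorem continuous_blockCostImpact (M : MarketModel T f lam rho) :
    Continuous (blockCostImpact M.T_pos.le f lam) :=
  M.continuous_shapeFInv.comp M.continuous_div_extendRate

theorem continuous_blockCostTime (M : MarketModel T f lam rho) :
    Continuous (blockCostTime M.T_pos.le f lam) :=
  ((continuous_extendRate _ M.contDiffOn_derivWithin_lam.continuousOn).comp continuous_fst).mul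
    ((M.continuous_shapeG.comp M.continuous_div_extendRate).sub
      (M.continuous_div_extendRate.mul M.continuous_blockCostImpact))

theorem hasDerivAt_blockCost (M : MarketModel T f lam rho) {t : ℝ} (ht : t ∈ Icc 0 T) (e : ℝ) :
    HasDerivAt (fun e => blockCost f lam (t, e)) (blockCostImpact M.T_pos.le f lam (t, e)) e := by
  have h := ((M.hasDerivAt_shapeG (e / lam t)).comp e
    ((hasDerivAt_id e).div_const (lam t))).const_mul (lam t)
  refine h.congr_deriv ?_
  have := (M.lam_pos t ht).ne'
  simp only [blockCostImpact, extendRate_of_mem _ _ ht]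
  field_simp

/-- The derivative is taken within the strip since `λ` is differentiable only within `[0, T]`. -/
theorem hasFDerivWithinAt_blockCost (M : MarketModel T f lam rho) {p : ℝ × ℝ}
    (hp : p ∈ Icc 0 T ×ˢ (univ : Set ℝ)) :
    HasFDerivWithinAt (blockCost f lam)
      (blockCostTime M.T_pos.le f lam p • ContinuousLinearMap.fst ℝ ℝ ℝ +
        blockCostImpact M.T_pos.le f lam p • ContinuousLinearMap.snd ℝ ℝ ℝ)
      (Icc 0 T ×ˢ univ) p := by
  have ht : p.1 ∈ Icc 0 T := hp.1
  have hne := (M.lam_pos _ ht).ne'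
  have h1 : HasFDerivWithinAt (fun q : ℝ × ℝ => lam q.1)
      (derivWithin lam (Icc 0 T) p.1 • ContinuousLinearMap.fst ℝ ℝ ℝ) (Icc 0 T ×ˢ univ) p :=
    (M.hasDerivWithinAt_lam ht).comp_hasFDerivWithinAt p hasFDerivWithinAt_fst fun q hq => hq.1
  have h2 : HasFDerivWithinAt (fun q : ℝ × ℝ => (lam q.1)⁻¹)
      ((-(lam p.1 ^ 2)⁻¹) • (derivWithin lam (Icc 0 T) p.1 • ContinuousLinearMap.fst ℝ ℝ ℝ))
      (Icc 0 T ×ˢ univ) p := (hasDerivAt_inv hne).comp_hasFDerivWithinAt p h1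
  have h3 : HasFDerivWithinAt (fun q : ℝ × ℝ => q.2) (ContinuousLinearMap.snd ℝ ℝ ℝ)
      (Icc 0 T ×ˢ univ) p := hasFDerivWithinAt_snd
  have h4 := h1.mul ((M.hasDerivAt_shapeG (p.2 * (lam p.1)⁻¹)).comp_hasFDerivWithinAt p
    (h3.mul h2))
  have h5 : blockCost f lam = fun q : ℝ × ℝ => lam q.1 * shapeG f (q.2 * (lam q.1)⁻¹) := by
    funext q; rw [blockCost, div_eq_mul_inv]
  rw [h5]
  refine h4.congr_fderiv ?_
  ext
  · simp only [blockCostTime, blockCostImpact, extendRate_of_mem _ _ ht, div_eq_mul_inv]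
    simp
    field_simp
    ring
  · simp only [blockCostTime, blockCostImpact, extendRate_of_mem _ _ ht, div_eq_mul_inv]
    simp
    field_simp

/-- The cost is well defined, and is a function of the volume impact. -/
theorem costV_spec (M : MarketModel T f lam rho) {x : ℝ} {X : ℝ → ℝ}
    (hX : AdmissiblePath T x X) :
    (pathMeasure X).IntegrableOn (priceImpact f lam rho X) (continuityTimes T X) ∧
    (Summable fun t : Icc (0 : ℝ) T => jumpCost f lam rho X t) ∧
    costV T f lam rho X = reducedCost T x f lam rho (volumeImpact rho X) := by
  have hrho := M.rho_contDiffOn.continuousOn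
  have hBV := hX.boundedVariation
  have hl := hX.leftContinuous
  set r := impactDrift T rho X with hr
  set m := pathMeasure X with hm
  have hri := intervalIntegrable_impactDrift M.T_pos.le hrho hBV
  obtain ⟨C, hC⟩ := exists_bound_impactDrift M.T_pos.le hrho hBV
  have hE : ∀ t ∈ Icc 0 T, volumeImpact rho X t = driftPath X r t := fun t ht =>
    volumeImpact_eq_driftPath hrho hBV ht
  set θ := jumpSlope (blockCost f lam) X r with hθ
  -- `[0, T]` splits into the continuity times, where `θ` is the price impact, and the countable set
  -- `J` of jump times, where the integral of `θ` is the sum of the jump costs. Together they form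
  -- the integral in the chain rule.
  set J : Set ℝ := {t | t ∈ Icc 0 T ∧ ¬ ContinuousAt X t} with hJ
  have hJc : J.Countable := (countable_not_continuousAt hBV).mono fun t ht => ht.2
  have hCJ : continuityTimes T X = Icc 0 T \ J := by
    ext t
    simp only [continuityTimes, hJ, mem_ofPred_eq, Set.mem_sdiff, not_and, not_not]
    exact ⟨fun h => ⟨h.1, fun _ => h.2⟩, fun h => ⟨h.1, h.2 h.1⟩⟩
  have hCm : MeasurableSet (continuityTimes T X) := by
    rw [hCJ]; exact measurableSet_Icc.diff hJc.measurableSet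
  have hθi : m.IntegrableOn θ (Icc 0 T) :=
    integrableOn_jumpSlope hBV hri (fun t ht e => M.hasDerivAt_blockCost ht e)
      M.continuous_blockCostImpact m
  have hθC : EqOn θ (priceImpact f lam rho X) (continuityTimes T X) := by
    intro t ht
    rw [hθ, jumpSlope_of_jump_eq_zero (M.hasDerivAt_blockCost ht.1)
      (jump_eq_zero_of_continuousAt ht.2), priceImpact, hE t ht.1, blockCostImpact]
    simp only [extendRate_of_mem _ _ ht.1]
  have hjump : ∀ t ∈ Icc 0 T, jumpCost f lam rho X t = θ t * jump X t := by
    intro t ht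
    rw [hθ, jumpSlope_mul_jump, jumpCost, hE t ht]
    simp only [blockCost]; ring
  have hsumJ : HasSum (fun t : J => jumpCost f lam rho X t) (∫ᵛ t in J, θ t ∂•m) := by
    have h := hasSum_setIntegral_of_countable hJc (hθi.mono measurableSet_Icc fun t ht => ht.1)
    refine h.congr_fun fun t => ?_
    rw [hjump t t.2.1, pathMeasure_singleton hBV hl]
  have hsum : HasSum (fun t : Icc (0 : ℝ) T => jumpCost f lam rho X t) (∫ᵛ t in J, θ t ∂•m) := by
    have h1 := (hasSum_subtype_iff_indicator (f := jumpCost f lam rho X) (s := J)).1 hsumJ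
    refine (hasSum_subtype_iff_indicator (f := jumpCost f lam rho X) (s := Icc 0 T)).2 ?_
    convert! h1 using 1
    ext t
    by_cases htJ : t ∈ J
    · rw [indicator_of_mem htJ, indicator_of_mem htJ.1]
    · rw [indicator_of_notMem htJ]
      by_cases ht : t ∈ Icc 0 T
      · have hc : ContinuousAt X t := by
          by_contra h; exact htJ ⟨ht, h⟩
        rw [indicator_of_mem ht, hjump t ht, jump_eq_zero_of_continuousAt hc, mul_zero]
      · rw [indicator_of_notMem ht]
  refine ⟨?_, hsum.summable, ?_⟩
  · have h1 : m.IntegrableOn θ (continuityTimes T X) :=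
      hθi.mono measurableSet_Icc fun t ht => ht.1
    simp only [VectorMeasure.IntegrableOn, VectorMeasure.Integrable,
      VectorMeasure.variation_restrict hCm] at h1 ⊢
    exact IntegrableOn.congr_fun h1 hθC hCm
  · have hsplit : (∫ᵛ t in continuityTimes T X, θ t ∂•m) + (∫ᵛ t in J, θ t ∂•m) =
        ∫ᵛ t in Icc 0 T, θ t ∂•m := by
      rw [hCJ, ← VectorMeasure.setIntegral_union disjoint_sdiff_left
        (measurableSet_Icc.diff hJc.measurableSet) hJc.measurableSet
        (hθi.mono measurableSet_Icc sdiff_subset) (hθi.mono measurableSet_Icc fun t ht => ht.1),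
        sdiff_union_of_subset fun t ht => ht.1]
    have hchain := chain_rule M.T_pos.le hBV hl hri hC
      (fun p hp => M.hasFDerivWithinAt_blockCost hp)
      (fun t ht e => M.hasDerivAt_blockCost ht e) M.continuous_blockCostTime
      M.continuous_blockCostImpact
    have hX0 : X 0 = x := hX.initial 0 le_rfl
    have hright : Function.rightLim X T = 0 := by
      refine tendsto_nhds_unique (hBV.tendsto_rightLim T) ?_
      refine tendsto_const_nhds.congr' ?_
      filter_upwards [self_mem_nhdsWithin] with t ht using (hX.terminal t ht).symm
    have hend : driftPath X r T + jump X T =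
        -x - ∫ s in (0 : ℝ)..T, rho s * volumeImpact rho X s := by
      rw [driftPath, jump, hright, hX0, integral_impactDrift rho X M.T_mem]; ring
    have hstart : driftPath X r 0 = 0 := by simp [driftPath]
    -- With `y = E / λ` and `λ' = λ η`, the integrand is `λ' (G(y) - y F⁻¹(y)) - ρ λ y F⁻¹(y)`.
    -- Factoring out `-λ ρ` leaves `a y F⁻¹(y) + (1 - a) G(y)` with `1 - a = -η / ρ`.
    have hint : (∫ t in (0 : ℝ)..T, (blockCostTime M.T_pos.le f lam (t, driftPath X r t) -
        blockCostImpact M.T_pos.le f lam (t, driftPath X r t) * r t)) =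
        -∫ t in (0 : ℝ)..T, lam t * rho t *
          hPrim f (impactCoeff T lam rho t) (volumeImpact rho X t / lam t) := by
      rw [← intervalIntegral.integral_neg]
      refine intervalIntegral.integral_congr fun t ht => ?_
      rw [uIcc_of_le M.T_pos.le] at ht
      have h1 := (M.lam_pos t ht).ne'
      have h2 := (M.rho_pos t ht).ne'
      have hrt : r t = rho t * volumeImpact rho X t := by
        rw [hr, impactDrift, indicator_of_mem ht]
      have hEt := (hE t ht).symm
      simp only [blockCostTime, blockCostImpact, extendRate_of_mem _ _ ht, hEt, hPrim,
        impactCoeff, eta, hrt]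
      field_simp
      ring
    rw [costV, VectorMeasure.setIntegral_congr_fun hθC.symm, hsum.tsum_eq, hsplit, hchain, hend,
      hstart, hint, reducedCost]
    simp only [blockCost, zero_div, M.shapeG_zero]
    ring

end MarketModel

theorem integral_congr_Ioc {g g' : ℝ → ℝ} {a b : ℝ} (hab : a ≤ b)
    (h : ∀ t ∈ Ioc a b, g t = g' t) : ∫ t in a..b, g t = ∫ t in a..b, g' t := by
  rw [intervalIntegral.integral_of_le hab, intervalIntegral.integral_of_le hab]
  exact setIntegral_congr_fun measurableSet_Ioc h

namespace MarketModel

variable {T x nu : ℝ} {f lam rho : ℝ → ℝ}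

/-! ### Minimisation of the reduced cost -/

theorem shapeG_nonneg (M : MarketModel T f lam rho) (y : ℝ) : 0 ≤ shapeG f y := by
  have := le_of_strictMono_hasDerivAt M.hasDerivAt_shapeG M.strictMono_shapeFInv 0 y
  simpa [M.shapeG_zero, M.shapeFInv_zero] using this

/-- The derivative `h_{V,t}` increases through `0` at the origin, where the function itself
vanishes: the tangent there is the zero line. -/
theorem hPrim_nonneg (M : MarketModel T f lam rho) {t : ℝ} (ht : t ∈ Icc 0 T) (y : ℝ) :
    0 ≤ hPrim f (impactCoeff T lam rho t) y := by
  have := le_of_strictMono_hasDerivAt (M.hasDerivAt_hPrim _) (M.strictMono_hCoeff ht) 0 y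
  simpa [M.hPrim_zero, M.hCoeff_zero] using this

theorem reducedCost_nonneg (M : MarketModel T f lam rho) (x : ℝ) (e : ℝ → ℝ) :
    0 ≤ reducedCost T x f lam rho e := by
  refine add_nonneg (mul_nonneg (M.lam_pos T M.T_mem).le (M.shapeG_nonneg _)) ?_
  refine intervalIntegral.integral_nonneg M.T_pos.le fun t ht => ?_
  exact mul_nonneg (mul_pos (M.lam_pos t ht) (M.rho_pos t ht)).le (M.hPrim_nonneg ht _)

/-- Time `0` is excluded because the impact of `X*` there is `0`, before its initial jump, and not
`λ(0) ζ_0`. -/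
theorem reducedCost_congr (M : MarketModel T f lam rho) {e e' : ℝ → ℝ}
    (h : ∀ t ∈ Ioc 0 T, e t = e' t) :
    reducedCost T x f lam rho e = reducedCost T x f lam rho e' := by
  unfold reducedCost
  congr 1
  · congr 4
    exact integral_congr_Ioc M.T_pos.le fun t ht => by simp only [h t ht]
  · exact integral_congr_Ioc M.T_pos.le fun t ht => by simp only [h t ht]

/-- The integrand of the running part of the reduced cost. -/
def runningCost (T : ℝ) (f lam rho : ℝ → ℝ) (t e : ℝ) : ℝ :=
  lam t * rho t * hPrim f (impactCoeff T lam rho t) (e / lam t)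

theorem continuousOn_runningCost (M : MarketModel T f lam rho) :
    ContinuousOn (fun p : ℝ × ℝ => runningCost T f lam rho p.1 p.2) (Icc 0 T ×ˢ univ) := by
  have h1 : MapsTo Prod.fst (Icc 0 T ×ˢ (univ : Set ℝ)) (Icc 0 T) := fun p hp => hp.1
  have hl := M.lam_contDiffOn.continuousOn.comp (continuousOn_fst (s := Icc 0 T ×ˢ univ)) h1
  have hr := M.rho_contDiffOn.continuousOn.comp (continuousOn_fst (s := Icc 0 T ×ˢ univ)) h1
  have ha := M.contDiffOn_impactCoeff.continuousOn.comp
    (continuousOn_fst (s := Icc 0 T ×ˢ univ)) h1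
  exact (hl.mul hr).mul (M.continuous_hPrim.comp_continuousOn
    (ha.prodMk (continuousOn_snd.div hl fun p hp => (M.lam_pos _ hp.1).ne')))

theorem exists_bound_runningCost (M : MarketModel T f lam rho) (K : ℝ) :
    ∃ B, ∀ t ∈ Icc 0 T, ∀ e, |e| ≤ K → |runningCost T f lam rho t e| ≤ B := by
  obtain ⟨B, hB⟩ := (isCompact_Icc.prod
    (isCompact_Icc (a := -K) (b := K))).exists_bound_of_continuousOn
    (M.continuousOn_runningCost.mono (prod_mono le_rfl (subset_univ _)))
  exact ⟨B, fun t ht e he => hB (t, e) ⟨ht, abs_le.1 he⟩⟩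

theorem intervalIntegrable_of_bounded {g : ℝ → ℝ} {B : ℝ} (hT : 0 ≤ T)
    (hg : AEStronglyMeasurable g (volume.restrict (Icc 0 T))) (hB : ∀ t ∈ Icc 0 T, |g t| ≤ B) :
    IntervalIntegrable g volume 0 T := by
  rw [intervalIntegrable_iff_integrableOn_Icc_of_le hT]
  exact Integrable.of_bound hg B ((ae_restrict_iff' measurableSet_Icc).2 (Eventually.of_forall hB))

theorem intervalIntegrable_rho_mul (M : MarketModel T f lam rho) {e : ℝ → ℝ} {K : ℝ}
    (he : AEStronglyMeasurable e (volume.restrict (Icc 0 T))) (hK : ∀ t ∈ Icc 0 T, |e t| ≤ K) :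
    IntervalIntegrable (fun t => rho t * e t) volume 0 T := by
  obtain ⟨R, hR⟩ := isCompact_Icc.exists_bound_of_continuousOn M.rho_contDiffOn.continuousOn
  refine intervalIntegrable_of_bounded (B := R * K) M.T_pos.le
    ((M.rho_contDiffOn.continuousOn.aestronglyMeasurable measurableSet_Icc).mul he) fun t ht => ?_
  rw [abs_mul]
  exact mul_le_mul (hR t ht) (hK t ht) (abs_nonneg _) ((norm_nonneg _).trans (hR t ht))

theorem intervalIntegrable_runningCost (M : MarketModel T f lam rho) {e : ℝ → ℝ} {K : ℝ}
    (he : AEStronglyMeasurable e (volume.restrict (Icc 0 T))) (hK : ∀ t ∈ Icc 0 T, |e t| ≤ K) :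
    IntervalIntegrable (fun t => runningCost T f lam rho t (e t)) volume 0 T := by
  obtain ⟨B, hB⟩ := M.exists_bound_runningCost K
  have hl := M.lam_contDiffOn.continuousOn.aestronglyMeasurable (μ := volume) measurableSet_Icc
  have hr := M.rho_contDiffOn.continuousOn.aestronglyMeasurable (μ := volume) measurableSet_Icc
  have ha := M.contDiffOn_impactCoeff.continuousOn.aestronglyMeasurable (μ := volume)
    measurableSet_Icc
  refine intervalIntegrable_of_bounded (B := B) M.T_pos.le ?_ fun t ht => hB t ht _ (hK t ht)
  exact (hl.mul hr).mul (M.continuous_hPrim.comp_aestronglyMeasurable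
    (ha.prodMk (he.aemeasurable.div hl.aemeasurable).aestronglyMeasurable))

/-- The impact `λ_t ζ_t` of the optimal strategy. -/
def optimalImpact (T : ℝ) (f lam rho : ℝ → ℝ) (nu t : ℝ) : ℝ := lam t * zeta T f lam rho nu t

theorem continuousOn_optimalImpact (M : MarketModel T f lam rho) (nu : ℝ) :
    ContinuousOn (optimalImpact T f lam rho nu) (Icc 0 T) :=
  M.lam_contDiffOn.continuousOn.mul (M.contDiffOn_zeta nu).continuousOn

theorem hCoeff_zeta (M : MarketModel T f lam rho) (nu : ℝ) {t : ℝ} (ht : t ∈ Icc 0 T) :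
    hCoeff f (impactCoeff T lam rho t) (zeta T f lam rho nu t) = nu := M.hV_hVInv ht nu

/-- Meaning of the equation for `ν`: a strategy with impact `λ ζ` has impact `λ(T) F(ν)` after its
final trade, so that its final price impact is `ν`. -/
theorem lam_mul_shapeF (hnu : MultiplierEq T x f lam rho nu) :
    lam T * shapeF f nu = -x - ∫ t in (0 : ℝ)..T, rho t * optimalImpact T f lam rho nu t := by
  have h : (∫ t in (0 : ℝ)..T, rho t * optimalImpact T f lam rho nu t) =
      ∫ t in (0 : ℝ)..T, lam t * rho t * hVInv T f lam rho t nu := by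
    refine intervalIntegral.integral_congr fun t _ => ?_
    simp only [optimalImpact, zeta]; ring
  rw [h, ← hnu]; ring

/-- The excess of the reduced cost over its minimum is a sum of two nonnegative terms. -/
theorem reducedCost_sub_eq (M : MarketModel T f lam rho) (hnu : MultiplierEq T x f lam rho nu)
    {e : ℝ → ℝ} {K : ℝ} (he : AEStronglyMeasurable e (volume.restrict (Icc 0 T)))
    (hK : ∀ t ∈ Icc 0 T, |e t| ≤ K) :
    ∃ (a : ℝ) (g : ℝ → ℝ), 0 ≤ a ∧ (∀ t ∈ Icc 0 T, 0 ≤ g t) ∧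
      (∀ t ∈ Icc 0 T, g t = 0 → e t = optimalImpact T f lam rho nu t) ∧
      IntervalIntegrable g volume 0 T ∧
      reducedCost T x f lam rho e =
        reducedCost T x f lam rho (optimalImpact T f lam rho nu) + (a + ∫ t in (0 : ℝ)..T, g t) := by
  have hlT := M.lam_pos T M.T_mem
  have hoc := M.continuousOn_optimalImpact nu
  have hom : AEStronglyMeasurable (optimalImpact T f lam rho nu) (volume.restrict (Icc 0 T)) :=
    hoc.aestronglyMeasurable measurableSet_Icc
  obtain ⟨K', hK'⟩ := isCompact_Icc.exists_bound_of_continuousOn hoc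
  set e' := optimalImpact T f lam rho nu with he'
  have i1 := M.intervalIntegrable_rho_mul he hK
  have i2 := M.intervalIntegrable_rho_mul hom hK'
  have i3 := M.intervalIntegrable_runningCost he hK
  have i4 := M.intervalIntegrable_runningCost hom hK'
  set Y := (-x - ∫ s in (0 : ℝ)..T, rho s * e s) / lam T with hY
  have hYe : lam T * Y = -x - ∫ s in (0 : ℝ)..T, rho s * e s := by rw [hY]; field_simp
  have hFe : lam T * shapeF f nu = -x - ∫ t in (0 : ℝ)..T, rho t * e' t := lam_mul_shapeF hnu
  have hF : (-x - ∫ t in (0 : ℝ)..T, rho t * e' t) / lam T = shapeF f nu := by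
    rw [← hFe]; field_simp
  -- The linear term has slope `ν` at every time, since `h_{V,t}(ζ_t) = ν`; `g` is therefore the gap
  -- between the convex running cost and its tangent at `ζ_t`.
  set g : ℝ → ℝ := fun t => runningCost T f lam rho t (e t) - runningCost T f lam rho t (e' t) -
    nu * (rho t * e t - rho t * e' t) with hg
  have hgeq : ∀ t ∈ Icc 0 T, g t = lam t * rho t *
      (hPrim f (impactCoeff T lam rho t) (e t / lam t) -
        (hPrim f (impactCoeff T lam rho t) (zeta T f lam rho nu t) +
          hCoeff f (impactCoeff T lam rho t) (zeta T f lam rho nu t) *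
            (e t / lam t - zeta T f lam rho nu t))) := by
    intro t ht
    have h1 := (M.lam_pos t ht).ne'
    have h2 : e' t / lam t = zeta T f lam rho nu t := by
      rw [he', optimalImpact]; field_simp
    have h3 : e' t = lam t * zeta T f lam rho nu t := rfl
    have h4 : e t = lam t * (e t / lam t) := by field_simp
    rw [M.hCoeff_zeta nu ht]
    simp only [hg, runningCost, h2]
    rw [h3]
    linear_combination (-nu * rho t) * h4
  -- `a` is the gap between `G` and its tangent at `F(ν)`, whose slope `F⁻¹(F(ν))` is again `ν`.
  refine ⟨lam T * (shapeG f Y - (shapeG f (shapeF f nu) + shapeFInv f (shapeF f nu) *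
    (Y - shapeF f nu))), g, ?_, ?_, ?_, ?_, ?_⟩
  · exact mul_nonneg hlT.le (sub_nonneg.2 (le_of_strictMono_hasDerivAt M.hasDerivAt_shapeG
      M.strictMono_shapeFInv _ _))
  · intro t ht
    rw [hgeq t ht]
    exact mul_nonneg (mul_pos (M.lam_pos t ht) (M.rho_pos t ht)).le (sub_nonneg.2
      (le_of_strictMono_hasDerivAt (M.hasDerivAt_hPrim _) (M.strictMono_hCoeff ht) _ _))
  · intro t ht h0
    rw [hgeq t ht] at h0
    by_contra hne
    have hne' : e t / lam t ≠ zeta T f lam rho nu t := by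
      intro h
      refine hne ?_
      rw [div_eq_iff (M.lam_pos t ht).ne'] at h
      rw [h, he', optimalImpact, mul_comm]
    have := lt_of_strictMono_hasDerivAt (M.hasDerivAt_hPrim (impactCoeff T lam rho t))
      (M.strictMono_hCoeff ht) hne'
    exact (mul_pos (mul_pos (M.lam_pos t ht) (M.rho_pos t ht)) (sub_pos.2 this)).ne' h0
  · exact (i3.sub i4).sub ((i1.sub i2).const_mul nu)
  · have hint : ∫ t in (0 : ℝ)..T, g t = (∫ t in (0 : ℝ)..T, runningCost T f lam rho t (e t)) -
        (∫ t in (0 : ℝ)..T, runningCost T f lam rho t (e' t)) -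
        nu * ((∫ t in (0 : ℝ)..T, rho t * e t) - ∫ t in (0 : ℝ)..T, rho t * e' t) := by
      rw [intervalIntegral.integral_sub (i3.sub i4) ((i1.sub i2).const_mul nu),
        intervalIntegral.integral_sub i3 i4, intervalIntegral.integral_const_mul,
        intervalIntegral.integral_sub i1 i2]
    rw [hint, M.shapeFInv_shapeF, reducedCost, reducedCost, ← hY, hF]
    simp only [runningCost]
    -- The terminal and running linear terms are both multiples by `ν` of `∫ ρ (e - e')`, with
    -- opposite signs.
    linear_combination nu * hYe - nu * hFe

theorem reducedCost_optimalImpact_le (M : MarketModel T f lam rho)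
    (hnu : MultiplierEq T x f lam rho nu) {e : ℝ → ℝ} {K : ℝ}
    (he : AEStronglyMeasurable e (volume.restrict (Icc 0 T))) (hK : ∀ t ∈ Icc 0 T, |e t| ≤ K) :
    reducedCost T x f lam rho (optimalImpact T f lam rho nu) ≤ reducedCost T x f lam rho e := by
  obtain ⟨a, g, ha, hg, -, -, h⟩ := M.reducedCost_sub_eq hnu he hK
  rw [h]
  have := intervalIntegral.integral_nonneg M.T_pos.le hg (μ := volume)
  linarith

/-- Both gaps are nonnegative, so equality of costs makes the running gap integrate to `0`; strict
convexity at almost every time does the rest. -/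
theorem ae_eq_optimalImpact (M : MarketModel T f lam rho)
    (hnu : MultiplierEq T x f lam rho nu) {e : ℝ → ℝ} {K : ℝ}
    (he : AEStronglyMeasurable e (volume.restrict (Icc 0 T))) (hK : ∀ t ∈ Icc 0 T, |e t| ≤ K)
    (heq : reducedCost T x f lam rho e =
      reducedCost T x f lam rho (optimalImpact T f lam rho nu)) :
    ∀ᵐ t ∂volume.restrict (Ioc 0 T), e t = optimalImpact T f lam rho nu t := by
  obtain ⟨a, g, ha, hg, hg0, hgi, h⟩ := M.reducedCost_sub_eq hnu he hK
  have h1 := intervalIntegral.integral_nonneg M.T_pos.le hg (μ := volume)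
  have h2 : ∫ t in (0 : ℝ)..T, g t = 0 := by linarith
  have h3 := (intervalIntegral.integral_eq_zero_iff_of_le_of_nonneg_ae M.T_pos.le
    ((ae_restrict_iff' measurableSet_Ioc).2 (Eventually.of_forall fun t ht =>
      hg t (Ioc_subset_Icc_self ht))) hgi).1 h2
  filter_upwards [h3, ae_restrict_mem measurableSet_Ioc] with t ht htI
  exact hg0 t (Ioc_subset_Icc_self htI) ht

/-! ### The optimal path -/

/-- The integral `∫₀ᵗ ρ_s λ(s) ζ_s ds`. -/
def optimalDecay (M : MarketModel T f lam rho) (nu t : ℝ) : ℝ :=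
  ∫ s in (0 : ℝ)..t, extendRate M.T_pos.le (fun s => rho s * optimalImpact T f lam rho nu s) s

theorem continuous_extendRate_decay (M : MarketModel T f lam rho) (nu : ℝ) :
    Continuous (extendRate M.T_pos.le fun s => rho s * optimalImpact T f lam rho nu s) :=
  continuous_extendRate _ (M.rho_contDiffOn.continuousOn.mul (M.continuousOn_optimalImpact nu))

theorem hasDerivAt_optimalDecay (M : MarketModel T f lam rho) (nu : ℝ) {t : ℝ}
    (ht : t ∈ Icc 0 T) :
    HasDerivAt (M.optimalDecay nu) (rho t * optimalImpact T f lam rho nu t) t := by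
  have h := ((M.continuous_extendRate_decay nu).integral_hasStrictDerivAt 0 t).hasDerivAt
  rwa [extendRate_of_mem _ _ ht] at h

theorem continuous_optimalDecay (M : MarketModel T f lam rho) (nu : ℝ) :
    Continuous (M.optimalDecay nu) :=
  intervalIntegral.continuous_primitive
    (fun _ _ => (M.continuous_extendRate_decay nu).intervalIntegrable _ _) 0

theorem optimalDecay_zero (M : MarketModel T f lam rho) (nu : ℝ) : M.optimalDecay nu 0 = 0 := by
  simp [optimalDecay]

theorem optimalDecay_eq (M : MarketModel T f lam rho) (nu : ℝ) {t : ℝ} (ht : t ∈ Icc 0 T) :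
    M.optimalDecay nu t = ∫ s in (0 : ℝ)..t, rho s * optimalImpact T f lam rho nu s := by
  refine intervalIntegral.integral_congr fun s hs => ?_
  rw [uIcc_of_le ht.1] at hs
  exact extendRate_of_mem _ _ ⟨hs.1, hs.2.trans ht.2⟩

/-- Since `λ η = λ'`, the rate is `(λ ζ)' + ρ λ ζ`. -/
theorem integral_tradingRate (M : MarketModel T f lam rho) (nu : ℝ) {t : ℝ} (ht : t ∈ Icc 0 T) :
    ∫ s in (0 : ℝ)..t, tradingRate T f lam rho nu s =
      optimalImpact T f lam rho nu t - optimalImpact T f lam rho nu 0 + M.optimalDecay nu t := by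
  have hsub : Icc 0 t ⊆ Icc 0 T := Icc_subset_Icc le_rfl ht.2
  have h := intervalIntegral.integral_eq_sub_of_hasDerivAt_of_le ht.1
    (f := fun s => optimalImpact T f lam rho nu s + M.optimalDecay nu s)
    (f' := tradingRate T f lam rho nu)
    (((M.continuousOn_optimalImpact nu).mono hsub).add (M.continuous_optimalDecay nu).continuousOn)
    (fun s hs => by
      have hsI : s ∈ Icc 0 T := hsub (Ioo_subset_Icc_self hs)
      have hnh : Icc 0 T ∈ 𝓝 s := Icc_mem_nhds hs.1 (hs.2.trans_le ht.2)
      have h1 := (M.hasDerivWithinAt_lam hsI).hasDerivAt hnh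
      have h2 := (((M.contDiffOn_zeta nu).differentiableOn (by norm_num)) s
        hsI).hasDerivWithinAt.hasDerivAt hnh
      refine ((h1.mul h2).add (M.hasDerivAt_optimalDecay nu hsI)).congr_deriv ?_
      have := (M.lam_pos s hsI).ne'
      simp only [tradingRate, eta, optimalImpact]
      field_simp
      ring)
    (ContinuousOn.intervalIntegrable (by
      rw [uIcc_of_le ht.1]; exact (M.continuousOn_tradingRate nu).mono hsub))
  rw [h, M.optimalDecay_zero]
  ring

theorem optimalPath_of_mem_Ioc (M : MarketModel T f lam rho) (x nu : ℝ) {t : ℝ}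
    (ht : t ∈ Ioc 0 T) : optimalPath T x f lam rho nu t =
      x + optimalImpact T f lam rho nu t + M.optimalDecay nu t := by
  rw [optimalPath, tradePath, if_pos ht.1, if_neg (not_lt.2 ht.2), min_eq_left ht.2,
    max_eq_right ht.1.le, M.integral_tradingRate nu ⟨ht.1.le, ht.2⟩]
  simp only [initialTrade, optimalImpact]
  ring

theorem optimalPath_of_nonpos (M : MarketModel T f lam rho) (x nu : ℝ) {t : ℝ} (ht : t ≤ 0) :
    optimalPath T x f lam rho nu t = x := by
  rw [optimalPath, tradePath, if_neg (not_lt.2 ht), if_neg (not_lt.2 (ht.trans M.T_pos.le)),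
    min_eq_left (ht.trans M.T_pos.le), max_eq_left ht]
  simp

/-- This is where the equation for `ν` makes the final trade close the position. -/
theorem optimalPath_of_lt (M : MarketModel T f lam rho) (hnu : MultiplierEq T x f lam rho nu)
    {t : ℝ} (ht : T < t) : optimalPath T x f lam rho nu t = 0 := by
  have h := lam_mul_shapeF hnu
  rw [← M.optimalDecay_eq nu M.T_mem] at h
  rw [optimalPath, tradePath, if_pos (M.T_pos.trans ht), if_pos ht, min_eq_right ht.le,
    max_eq_right M.T_pos.le, M.integral_tradingRate nu M.T_mem]
  simp only [initialTrade, finalTrade, optimalImpact] at h ⊢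
  linear_combination h

theorem continuousWithinAt_step (c k t₀ : ℝ) :
    ContinuousWithinAt (fun t : ℝ => if c < t then k else 0) (Iic t₀) t₀ := by
  by_cases h : c < t₀
  · refine (continuousAt_const (y := k)).congr ?_ |>.continuousWithinAt
    filter_upwards [lt_mem_nhds h] with t ht using (if_pos ht).symm
  · refine (continuousWithinAt_const (b := (0 : ℝ))).congr (fun t ht => ?_) (if_neg h)
    exact if_neg fun h' => h (h'.trans_le ht)

theorem boundedVariationOn_step (c k : ℝ) :
    BoundedVariationOn (fun t : ℝ => if c < t then k else 0) univ := by
  have h1 : BoundedVariationOn (fun t : ℝ => if c < t then (1 : ℝ) else 0) univ := by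
    refine boundedVariationOn_of_monotone (c := 0) (d := 1) (fun s t hst => ?_)
      (fun t => ?_) fun t => ?_
    · split_ifs with h h' h'
      · exact le_rfl
      · exact absurd (h.trans_le hst) h'
      · exact zero_le_one
      · exact le_rfl
    · split_ifs <;> norm_num
    · split_ifs <;> norm_num
  have h2 := (boundedVariationOn_const k).mul h1
  convert! h2 using 2 with t
  simp

theorem admissiblePath_optimalPath (M : MarketModel T f lam rho)
    (hnu : MultiplierEq T x f lam rho nu) :
    AdmissiblePath T x (optimalPath T x f lam rho nu) := by
  have hc := continuous_extendRate M.T_pos.le (M.continuousOn_tradingRate nu)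
  set L : ℝ → ℝ := fun u => ∫ s in (0 : ℝ)..u,
    extendRate M.T_pos.le (tradingRate T f lam rho nu) s with hL
  have hLc : Continuous L :=
    intervalIntegral.continuous_primitive (fun _ _ => hc.intervalIntegrable _ _) 0
  have hform : optimalPath T x f lam rho nu = fun t => x +
      (if 0 < t then initialTrade T f lam rho nu else 0) + L (max 0 (min t T)) +
      (if T < t then finalTrade T f lam rho nu else 0) := by
    funext t
    rw [optimalPath, tradePath]
    congr 2
    refine intervalIntegral.integral_congr fun s hs => ?_
    rw [uIcc_of_le (le_max_left _ _)] at hs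
    exact (extendRate_of_mem _ _ ⟨hs.1, hs.2.trans (max_le M.T_pos.le (min_le_right _ _))⟩).symm
  refine ⟨fun t ht => M.optimalPath_of_nonpos x nu ht, fun t ht => M.optimalPath_of_lt hnu ht,
    fun t => ?_, ?_⟩
  · rw [hform]
    exact ((continuousWithinAt_const.add (continuousWithinAt_step 0 _ t)).add
      (hLc.comp (continuous_const.max (continuous_id.min continuous_const))).continuousWithinAt).add
      (continuousWithinAt_step T _ t)
  · rw [hform]
    refine boundedVariationOn_add (boundedVariationOn_add (boundedVariationOn_add
      (boundedVariationOn_const x) (boundedVariationOn_step 0 _)) ?_) (boundedVariationOn_step T _)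
    obtain ⟨C, hC⟩ := isCompact_Icc.exists_bound_of_continuousOn (M.continuousOn_tradingRate nu)
    have hlip : LipschitzOnWith C.toNNReal L univ := by
      refine LipschitzOnWith.of_dist_le_mul fun a _ b _ => ?_
      have h1 : L a - L b = ∫ s in b..a,
          extendRate M.T_pos.le (tradingRate T f lam rho nu) s :=
        intervalIntegral.integral_interval_sub_left (hc.intervalIntegrable _ _)
          (hc.intervalIntegrable _ _)
      rw [Real.dist_eq, h1, Real.dist_eq]
      exact intervalIntegral.norm_integral_le_of_norm_le_const fun s _ =>
        (hC _ (projIcc 0 T M.T_pos.le s).2).trans (Real.le_coe_toNNReal C)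
    refine hlip.comp_boundedVariationOn (g := fun t => max 0 (min t T)) (mapsTo_univ _ _) ?_
    exact boundedVariationOn_of_monotone (c := 0) (d := T)
      (fun s t hst => max_le_max le_rfl (min_le_min hst le_rfl)) (fun t => le_max_left _ _)
      fun t => max_le M.T_pos.le (min_le_right _ _)

/-- With `R` for `∫ ρ` and `I` for `∫ ρ λ ζ`, the function `exp(R) I` has derivative `ρ exp(R) (λ ζ
+ I)`. This is the kernel times `X* - x`, so the correction term in the impact is exactly `I`. -/
theorem volumeImpact_optimalPath (M : MarketModel T f lam rho) (x nu : ℝ) {t : ℝ}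
    (ht : t ∈ Ioc 0 T) :
    volumeImpact rho (optimalPath T x f lam rho nu) t = optimalImpact T f lam rho nu t := by
  have hT := M.T_pos.le
  have hrho := M.rho_contDiffOn.continuousOn
  have hsub : Icc 0 t ⊆ Icc 0 T := Icc_subset_Icc le_rfl ht.2
  rw [volumeImpact_eq_exp hT hrho _ (Ioc_subset_Icc_self ht), M.optimalPath_of_nonpos x nu le_rfl,
    M.optimalPath_of_mem_Ioc x nu ht]
  have h1 : (∫ s in (0 : ℝ)..t, rateKernel hT rho s * (optimalPath T x f lam rho nu s - x)) =
      ∫ s in (0 : ℝ)..t, rateKernel hT rho s *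
        (optimalImpact T f lam rho nu s + M.optimalDecay nu s) := by
    refine integral_congr_Ioc ht.1.le fun s hs => ?_
    simp only [M.optimalPath_of_mem_Ioc x nu ⟨hs.1, hs.2.trans ht.2⟩]
    ring
  have h2 := intervalIntegral.integral_eq_sub_of_hasDerivAt_of_le ht.1.le
    (f := fun s => Real.exp (rateIntegral hT rho s) * M.optimalDecay nu s)
    (f' := fun s => rateKernel hT rho s *
        (optimalImpact T f lam rho nu s + M.optimalDecay nu s))
    ((Real.continuous_exp.comp (continuous_rateIntegral hT hrho)).mul
      (M.continuous_optimalDecay nu)).continuousOn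
    (fun s hs => by
      have hsI : s ∈ Icc 0 T := hsub (Ioo_subset_Icc_self hs)
      have h3 : HasDerivAt (rateIntegral hT rho) (extendRate hT rho s) s :=
        ((continuous_extendRate hT hrho).integral_hasStrictDerivAt 0 s).hasDerivAt
      refine (h3.exp.mul (M.hasDerivAt_optimalDecay nu hsI)).congr_deriv ?_
      rw [rateKernel, extendRate_of_mem _ _ hsI]
      ring)
    (ContinuousOn.intervalIntegrable (by
      rw [uIcc_of_le ht.1.le]
      exact (continuous_rateKernel hT hrho).continuousOn.mul
        (((M.continuousOn_optimalImpact nu).mono hsub).add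
          (M.continuous_optimalDecay nu).continuousOn)))
  rw [h1, h2, M.optimalDecay_zero]
  have h4 : Real.exp (-rateIntegral hT rho t) * Real.exp (rateIntegral hT rho t) = 1 := by
    rw [← Real.exp_add]; simp
  linear_combination (-M.optimalDecay nu t) * h4

theorem costV_optimalPath (M : MarketModel T f lam rho) (hnu : MultiplierEq T x f lam rho nu) :
    costV T f lam rho (optimalPath T x f lam rho nu) =
      reducedCost T x f lam rho (optimalImpact T f lam rho nu) := by
  rw [(M.costV_spec (M.admissiblePath_optimalPath hnu)).2.2]
  exact M.reducedCost_congr fun t ht => M.volumeImpact_optimalPath x nu ht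

/-! ### Optimality among paths -/

theorem exists_bound_volumeImpact_of_admissible (M : MarketModel T f lam rho) {X : ℝ → ℝ}
    (hX : AdmissiblePath T x X) : ∃ K, ∀ t ∈ Icc 0 T, |volumeImpact rho X t| ≤ K := by
  obtain ⟨A, hA⟩ := exists_bound_volumeImpact M.T_pos.le M.rho_contDiffOn.continuousOn
  obtain ⟨K, hK⟩ := exists_bound_of_boundedVariationOn hX.boundedVariation
  exact ⟨A * K, hA X K hK⟩

theorem costV_optimalPath_le (M : MarketModel T f lam rho) (hnu : MultiplierEq T x f lam rho nu)
    {X : ℝ → ℝ} (hX : AdmissiblePath T x X) :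
    costV T f lam rho (optimalPath T x f lam rho nu) ≤ costV T f lam rho X := by
  obtain ⟨K, hK⟩ := M.exists_bound_volumeImpact_of_admissible hX
  rw [M.costV_optimalPath hnu, (M.costV_spec hX).2.2]
  exact M.reducedCost_optimalImpact_le hnu
    (aestronglyMeasurable_volumeImpact M.T_pos.le M.rho_contDiffOn.continuousOn
      hX.boundedVariation) hK

/-- Equality of costs identifies the impacts only almost everywhere. Both are left-continuous on
`(0, T]`, hence agree there at every time, and the path is recovered as `x + E + ∫ ρ E`. -/
theorem eq_optimalPath_of_costV_eq (M : MarketModel T f lam rho)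
    (hnu : MultiplierEq T x f lam rho nu) {X : ℝ → ℝ} (hX : AdmissiblePath T x X)
    (hcost : costV T f lam rho X = costV T f lam rho (optimalPath T x f lam rho nu)) :
    X = optimalPath T x f lam rho nu := by
  obtain ⟨K, hK⟩ := M.exists_bound_volumeImpact_of_admissible hX
  have hrho := M.rho_contDiffOn.continuousOn
  have hBV := hX.boundedVariation
  rw [M.costV_optimalPath hnu, (M.costV_spec hX).2.2] at hcost
  have hae := M.ae_eq_optimalImpact hnu
    (aestronglyMeasurable_volumeImpact M.T_pos.le hrho hBV) hK hcost
  rw [ae_restrict_iff' measurableSet_Ioc] at hae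
  have hE : ∀ t ∈ Ioc 0 T, volumeImpact rho X t = optimalImpact T f lam rho nu t := by
    intro t ht
    have htI := Ioc_subset_Icc_self ht
    have hIoo : Ioo 0 t ∈ 𝓝[<] t := Ioo_mem_nhdsLT ht.1
    have h1 : Tendsto (volumeImpact rho X) (𝓝[<] t) (𝓝 (volumeImpact rho X t)) := by
      rw [volumeImpact_eq_driftPath hrho hBV htI]
      refine (tendsto_driftPath_nhdsLT hX.leftContinuous
        (intervalIntegrable_impactDrift M.T_pos.le hrho hBV) t).congr' ?_
      filter_upwards [hIoo] with s hs
      exact (volumeImpact_eq_driftPath hrho hBV ⟨hs.1.le, hs.2.le.trans ht.2⟩).symm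
    have h2 : Tendsto (optimalImpact T f lam rho nu) (𝓝[<] t)
        (𝓝 (optimalImpact T f lam rho nu t)) := by
      refine (M.continuousOn_optimalImpact nu t htI).tendsto.mono_left ?_
      exact nhdsWithin_le_iff.2 (mem_of_superset hIoo fun s hs => ⟨hs.1.le, hs.2.le.trans ht.2⟩)
    -- A disagreement at `t` would persist on an interval to the left of `t`, which has positive
    -- measure.
    by_contra hne
    have h3 : ∀ᶠ s in 𝓝[<] t, volumeImpact rho X s - optimalImpact T f lam rho nu s ≠ 0 :=
      (h1.sub h2).eventually_ne (sub_ne_zero.2 hne)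
    obtain ⟨u, hu, hu'⟩ := (mem_nhdsLT_iff_exists_Ioo_subset).1 (h3.and hIoo)
    have hzero : volume (Ioo u t) = 0 := by
      refine measure_mono_null (fun s hs => ?_) hae
      have h4 := hu' hs
      simp only [mem_compl_iff, mem_ofPred_eq, Classical.not_imp]
      exact ⟨⟨h4.2.1, h4.2.2.le.trans ht.2⟩, sub_ne_zero.1 h4.1⟩
    rw [Real.volume_Ioo, ENNReal.ofReal_eq_zero] at hzero
    exact absurd (show u < t from hu) (not_lt.2 (by linarith))
  funext t
  rcases le_or_gt t 0 with h0 | h0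
  · rw [hX.initial t h0, M.optimalPath_of_nonpos x nu h0]
  rcases lt_or_ge T t with hT | hT
  · rw [hX.terminal t hT, M.optimalPath_of_lt hnu hT]
  have ht : t ∈ Ioc 0 T := ⟨h0, hT⟩
  have h1 := volumeImpact_eq hrho hBV (Ioc_subset_Icc_self ht)
  have h2 : (∫ s in (0 : ℝ)..t, rho s * volumeImpact rho X s) = M.optimalDecay nu t := by
    rw [M.optimalDecay_eq nu (Ioc_subset_Icc_self ht)]
    refine integral_congr_Ioc h0.le fun s hs => ?_
    simp only [hE s ⟨hs.1, hs.2.trans hT⟩]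
  rw [h2, hE t ht, hX.initial 0 le_rfl] at h1
  rw [M.optimalPath_of_mem_Ioc x nu ht]
  linarith

end MarketModel

/-! ### Random strategies -/

/-- The volume impact of a measurable process, as a jointly measurable function. -/
def impactProcess {Ω : Type*} {T : ℝ} (hT : 0 ≤ T) (rho : ℝ → ℝ) (X : ℝ → Ω → ℝ) (p : ℝ × Ω) : ℝ :=
  X p.1 p.2 - X 0 p.2 - Real.exp (-rateIntegral hT rho p.1) *
    ∫ s, indicator (Ioc 0 p.1) (fun s => rateKernel hT rho s * (X s p.2 - X 0 p.2)) s

theorem impactProcess_eq {Ω : Type*} {T : ℝ} (hT : 0 ≤ T) {rho : ℝ → ℝ} (hrho : ContinuousOn rho (Icc 0 T))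
    (X : ℝ → Ω → ℝ) {t : ℝ} (ht : t ∈ Icc 0 T) (ω : Ω) :
    impactProcess hT rho X (t, ω) = volumeImpact rho (fun t => X t ω) t := by
  rw [volumeImpact_eq_exp hT hrho _ ht, intervalIntegral.integral_of_le ht.1,
    ← integral_indicator measurableSet_Ioc]
  rfl

/-! ### Joint measurability of left-continuous processes and of their impact -/

section Measurability

variable {Ω : Type*} [mΩ : MeasurableSpace Ω]

/-- A left-continuous process is jointly measurable. -/
theorem measurable_uncurry_of_leftContinuous {Y : ℝ → Ω → ℝ} (hm : ∀ t, Measurable (Y t))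
    (hl : ∀ ω t, ContinuousWithinAt (fun t => Y t ω) (Iic t) t) :
    Measurable (Function.uncurry Y) := by
  -- Time is replaced by the largest point of the grid of mesh `1 / (n + 1)` strictly below it;
  -- these points converge from the left, the side on which the paths are continuous.
  refine measurable_of_tendsto_metrizable
    (f := fun (n : ℕ) (p : ℝ × Ω) => Y ((⌈((n : ℝ) + 1) * p.1⌉ - 1 : ℝ) / (n + 1)) p.2)
    (fun n => ?_) (tendsto_pi_nhds.2 fun p => ?_)
  · have h1 : Measurable fun q : ℤ × Ω => Y (((q.1 : ℝ) - 1) / (n + 1)) q.2 :=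
      measurable_from_prod_countable_right fun k => hm (((k : ℝ) - 1) / (n + 1))
    exact h1.comp ((Int.measurable_ceil.comp (measurable_fst.const_mul _)).prodMk measurable_snd)
  · have hlt : ∀ n : ℕ, (⌈((n : ℝ) + 1) * p.1⌉ - 1 : ℝ) / (n + 1) ≤ p.1 := fun n => by
      rw [div_le_iff₀ (by positivity)]
      linarith [Int.ceil_lt_add_one (((n : ℝ) + 1) * p.1)]
    have hge : ∀ n : ℕ, p.1 - 1 / ((n : ℝ) + 1) ≤ (⌈((n : ℝ) + 1) * p.1⌉ - 1 : ℝ) / (n + 1) :=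
      fun n => by
      have : (0 : ℝ) < n + 1 := by positivity
      rw [le_div_iff₀ this, sub_mul, div_mul_cancel₀ _ this.ne']
      linarith [Int.le_ceil (((n : ℝ) + 1) * p.1)]
    refine (hl p.2 p.1).tendsto.comp (tendsto_nhdsWithin_iff.2 ⟨?_, Eventually.of_forall hlt⟩)
    refine tendsto_of_tendsto_of_tendsto_of_le_of_le ?_ tendsto_const_nhds hge hlt
    simpa using tendsto_const_nhds.sub (tendsto_one_div_add_atTop_nhds_zero_nat (𝕜 := ℝ))
      (a := p.1)

theorem measurable_integral_Ioc {g : ℝ → Ω → ℝ} (hg : Measurable (Function.uncurry g)) :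
    Measurable fun p : ℝ × Ω => ∫ s, indicator (Ioc 0 p.1) (fun s => g s p.2) s := by
  have hs : MeasurableSet {q : (ℝ × Ω) × ℝ | 0 < q.2 ∧ q.2 ≤ q.1.1} :=
    (measurableSet_lt measurable_const measurable_snd).inter
      (measurableSet_le measurable_snd measurable_fst.fst)
  have h1 : Measurable fun q : (ℝ × Ω) × ℝ => g q.2 q.1.2 :=
    hg.comp (measurable_snd.prodMk measurable_fst.snd)
  exact ((h1.indicator hs).stronglyMeasurable.integral_prod_right').measurable

theorem measurable_intervalIntegral {g : ℝ → Ω → ℝ} (hg : Measurable (Function.uncurry g))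
    {T : ℝ} (hT : 0 ≤ T) : Measurable fun ω => ∫ s in (0 : ℝ)..T, g s ω := by
  convert! (measurable_integral_Ioc hg).comp (measurable_prodMk_left (x := T)) using 1
  funext ω
  rw [intervalIntegral.integral_of_le hT, ← integral_indicator measurableSet_Ioc]
  rfl

theorem measurable_impactProcess {T : ℝ} (hT : 0 ≤ T) {rho : ℝ → ℝ}
    (hrho : ContinuousOn rho (Icc 0 T)) {X : ℝ → Ω → ℝ} (hX : Measurable (Function.uncurry X)) :
    Measurable (impactProcess hT rho X) := by
  have h0 : Measurable fun p : ℝ × Ω => X 0 p.2 :=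
    hX.comp (measurable_const.prodMk measurable_snd)
  have h1 : Measurable fun p : ℝ × Ω => X p.1 p.2 - X 0 p.2 := Measurable.sub hX h0
  have h2 : Measurable fun p : ℝ × Ω => rateKernel hT rho p.1 * (X p.1 p.2 - X 0 p.2) :=
    ((continuous_rateKernel hT hrho).measurable.comp measurable_fst).mul h1
  exact h1.sub (((Real.continuous_exp.comp
    (continuous_rateIntegral hT hrho).neg).measurable.comp measurable_fst).mul
    (measurable_integral_Ioc (g := fun s ω => rateKernel hT rho s * (X s ω - X 0 ω)) h2))

end Measurability

/-! ### Expected costs of random strategies -/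

namespace MarketModel

variable {T x nu : ℝ} {f lam rho : ℝ → ℝ} {Ω : Type*} [mΩ : MeasurableSpace Ω]

/-- Regularity of `ρ` and `λ` is known only on `[0, T]`, so the integrands are first replaced by
versions with time projected onto this interval. -/
theorem measurable_reducedCost (M : MarketModel T f lam rho) {e : ℝ × Ω → ℝ} (he : Measurable e) :
    Measurable fun ω => reducedCost T x f lam rho fun t => e (t, ω) := by
  have hT := M.T_pos.le
  have h1 : Measurable fun ω => ∫ s in (0 : ℝ)..T, extendRate hT rho s * e (s, ω) :=
    measurable_intervalIntegral (g := fun s ω => extendRate hT rho s * e (s, ω))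
      (((continuous_extendRate hT M.rho_contDiffOn.continuousOn).measurable.comp
        measurable_fst).mul he) hT
  have hrc : Continuous fun p : ℝ × ℝ => runningCost T f lam rho (projIcc 0 T hT p.1) p.2 :=
    M.continuousOn_runningCost.comp_continuous
      (f := fun p : ℝ × ℝ => ((projIcc 0 T hT p.1 : ℝ), p.2))
      ((continuous_subtype_val.comp (continuous_projIcc.comp continuous_fst)).prodMk
        continuous_snd) fun p => ⟨(projIcc 0 T hT p.1).2, mem_univ _⟩
  have h2 : Measurable fun ω =>
      ∫ s in (0 : ℝ)..T, runningCost T f lam rho (projIcc 0 T hT s) (e (s, ω)) :=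
    measurable_intervalIntegral (g := fun s ω => runningCost T f lam rho (projIcc 0 T hT s)
      (e (s, ω))) (hrc.measurable.comp (measurable_fst.prodMk he)) hT
  convert! ((M.continuous_shapeG.measurable.comp
    ((h1.const_sub (-x)).div_const (lam T))).const_mul (lam T)).add h2 using 1
  funext ω
  simp only [reducedCost, Pi.add_apply, Function.comp_apply]
  congr 1
  · congr 4
    exact integral_congr_Ioc hT fun s hs => by
      rw [extendRate_of_mem _ _ (Ioc_subset_Icc_self hs)]
  · exact integral_congr_Ioc hT fun s hs => by
      rw [projIcc_of_mem hT (Ioc_subset_Icc_self hs), runningCost]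

theorem exists_bound_reducedCost (M : MarketModel T f lam rho) (x K : ℝ) :
    ∃ C, ∀ e : ℝ → ℝ, (∀ t ∈ Icc 0 T, |e t| ≤ K) → |reducedCost T x f lam rho e| ≤ C := by
  obtain ⟨R, hR⟩ := isCompact_Icc.exists_bound_of_continuousOn M.rho_contDiffOn.continuousOn
  obtain ⟨B, hB⟩ := M.exists_bound_runningCost K
  set L := |x| + R * K * T with hL
  obtain ⟨D, hD⟩ := (isCompact_Icc (a := -(L / lam T)) (b := L / lam T)).exists_bound_of_continuousOn
    M.continuous_shapeG.continuousOn
  have hlT := M.lam_pos T M.T_mem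
  refine ⟨lam T * D + B * T, fun e he => ?_⟩
  have h1 := intervalIntegral.norm_integral_le_of_norm_le_const (a := 0) (b := T)
    (f := fun s => rho s * e s) (C := R * K) fun s hs => by
      rw [uIoc_of_le M.T_pos.le] at hs
      have hs := Ioc_subset_Icc_self hs
      rw [norm_mul]
      exact mul_le_mul (hR s hs) (he s hs) (norm_nonneg _) ((norm_nonneg _).trans (hR s hs))
  have h2 := intervalIntegral.norm_integral_le_of_norm_le_const (a := 0) (b := T)
    (f := fun s => runningCost T f lam rho s (e s)) (C := B) fun s hs => by
      rw [uIoc_of_le M.T_pos.le] at hs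
      have hs := Ioc_subset_Icc_self hs
      exact hB s hs _ (he s hs)
  rw [sub_zero, abs_of_pos M.T_pos] at h1 h2
  rw [reducedCost]
  refine (abs_add_le _ _).trans (add_le_add ?_ h2)
  rw [abs_mul, abs_of_pos hlT]
  refine mul_le_mul_of_nonneg_left (hD _ (abs_le.1 ?_)) hlT.le
  rw [abs_div, abs_of_pos hlT]
  gcongr
  refine (abs_sub _ _).trans ?_
  rw [abs_neg, hL]
  exact add_le_add le_rfl h1

/-- An admissible strategy has a version all of whose paths are admissible. -/
theorem exists_admissible_version (M : MarketModel T f lam rho) {P : Measure Ω}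
    {ℱ : Filtration ℝ≥0 mΩ} {X : ℝ → Ω → ℝ} (hX : AdmissibleStrategy P ℱ T x X) :
    ∃ Y : ℝ → Ω → ℝ, (∀ t, Measurable (Y t)) ∧ (∀ ω, AdmissiblePath T x fun t => Y t ω) ∧
      (∃ K : ℝ, ∀ ω t, |Y t ω - Y 0 ω| ≤ K) ∧ ∀ᵐ ω ∂P, ∀ t, Y t ω = X t ω := by
  obtain ⟨nu, hnu, -⟩ := M.existsUnique_multiplierEq x
  have hZ := M.admissiblePath_optimalPath hnu
  set Z := optimalPath T x f lam rho nu
  obtain ⟨KZ, hKZ⟩ := exists_bound_of_boundedVariationOn hZ.boundedVariation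
  obtain ⟨V, hV⟩ := hX.bounded
  -- The exceptional null set is enlarged to a measurable one, on which the paths are replaced by a
  -- fixed deterministic admissible path. The version is only required to be measurable, not
  -- adapted.
  set S : Set Ω := toMeasurable P {ω | ¬ (AdmissiblePath T x (fun t => X t ω) ∧
    eVariationOn (fun t => X t ω) univ ≤ (V : ℝ≥0∞))} with hS
  have hS0 : P S = 0 := by
    rw [hS, measure_toMeasurable]
    exact hX.path.and hV
  have hSm : MeasurableSet S := measurableSet_toMeasurable _ _
  have hgood : ∀ ω ∉ S, AdmissiblePath T x (fun t => X t ω) ∧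
      eVariationOn (fun t => X t ω) univ ≤ (V : ℝ≥0∞) := fun ω hω => by
    by_contra h
    exact hω (subset_toMeasurable _ _ h)
  classical
  set Y : ℝ → Ω → ℝ := fun t ω => if ω ∈ S then Z t else X t ω with hY
  have hYS : ∀ ω ∈ S, (fun t => Y t ω) = Z := fun ω hω => funext fun t => if_pos hω
  have hYX : ∀ ω ∉ S, (fun t => Y t ω) = fun t => X t ω := fun ω hω => funext fun t => if_neg hω
  refine ⟨Y, fun t => ?_, fun ω => ?_, ⟨max KZ V, fun ω t => ?_⟩, ?_⟩
  -- Adaptedness says nothing outside `[0, T]`, but there every admissible path takes a prescribed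
  -- value.
  · by_cases h0 : t ≤ 0
    · have : Y t = fun _ => x := funext fun ω => by
        by_cases hω : ω ∈ S
        · exact (congrFun (hYS ω hω) t).trans (hZ.initial t h0)
        · exact (congrFun (hYX ω hω) t).trans ((hgood ω hω).1.initial t h0)
      rw [this]; exact measurable_const
    by_cases hT : T < t
    · have : Y t = fun _ => 0 := funext fun ω => by
        by_cases hω : ω ∈ S
        · exact (congrFun (hYS ω hω) t).trans (hZ.terminal t hT)
        · exact (congrFun (hYX ω hω) t).trans ((hgood ω hω).1.terminal t hT)
      rw [this]; exact measurable_const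
    have hm := (hX.adapted ⟨t, (not_le.1 h0).le⟩ (not_lt.1 hT)).mono (ℱ.le _) le_rfl
    exact Measurable.ite hSm measurable_const hm
  · by_cases hω : ω ∈ S
    · rw [hYS ω hω]; exact hZ
    · rw [hYX ω hω]; exact (hgood ω hω).1
  · by_cases hω : ω ∈ S
    · rw [congrFun (hYS ω hω) t, congrFun (hYS ω hω) 0]
      exact (hKZ t).trans (le_max_left _ _)
    · rw [congrFun (hYX ω hω) t, congrFun (hYX ω hω) 0]
      exact (abs_sub_le_of_eVariationOn_le (hgood ω hω).2 t 0).trans (le_max_right _ _)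
  · filter_upwards [measure_eq_zero_iff_ae_notMem.1 hS0] with ω hω t
    exact if_neg hω

/-- The measure `dX` varies with `ω`, so measurability is obtained through the reduced cost of a
jointly measurable impact. That cost is bounded because the impact is bounded uniformly in `ω`. -/
theorem integrable_costV (M : MarketModel T f lam rho) {P : Measure Ω} [IsFiniteMeasure P]
    {ℱ : Filtration ℝ≥0 mΩ} {X : ℝ → Ω → ℝ} (hX : AdmissibleStrategy P ℱ T x X) :
    Integrable (fun ω => costV T f lam rho fun t => X t ω) P := by
  have hT := M.T_pos.le
  have hrho := M.rho_contDiffOn.continuousOn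
  obtain ⟨Y, hYm, hYp, ⟨K, hK⟩, hYX⟩ := M.exists_admissible_version hX
  have hYj : Measurable (Function.uncurry Y) :=
    measurable_uncurry_of_leftContinuous hYm fun ω => (hYp ω).leftContinuous
  obtain ⟨A, hA⟩ := exists_bound_volumeImpact hT hrho
  obtain ⟨C, hC⟩ := M.exists_bound_reducedCost x (A * K)
  have hmeas := M.measurable_reducedCost (x := x) (measurable_impactProcess hT hrho hYj)
  have heq : ∀ ω, (reducedCost T x f lam rho fun t => impactProcess hT rho Y (t, ω)) =
      costV T f lam rho fun t => Y t ω := fun ω => by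
    rw [(M.costV_spec (hYp ω)).2.2]
    exact M.reducedCost_congr fun t ht => impactProcess_eq hT hrho Y (Ioc_subset_Icc_self ht) ω
  refine (Integrable.of_bound hmeas.aestronglyMeasurable C (Eventually.of_forall fun ω => ?_)).congr
    ?_
  · refine hC _ fun t ht => ?_
    rw [impactProcess_eq hT hrho Y ht]
    exact hA _ K (hK ω) t ht
  · filter_upwards [hYX] with ω hω
    rw [heq, funext hω]

theorem admissibleStrategy_optimalPath (M : MarketModel T f lam rho)
    (hnu : MultiplierEq T x f lam rho nu) (P : Measure Ω) (ℱ : Filtration ℝ≥0 mΩ) :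
    AdmissibleStrategy P ℱ T x fun t _ => optimalPath T x f lam rho nu t where
  adapted _ _ := measurable_const
  path := Eventually.of_forall fun _ => M.admissiblePath_optimalPath hnu
  bounded := ⟨_, Eventually.of_forall fun _ =>
    (ENNReal.coe_toNNReal (M.admissiblePath_optimalPath hnu).boundedVariation).ge⟩

theorem ae_costV_optimalPath_le (M : MarketModel T f lam rho)
    (hnu : MultiplierEq T x f lam rho nu) {P : Measure Ω} {ℱ : Filtration ℝ≥0 mΩ} {X : ℝ → Ω → ℝ}
    (hX : AdmissibleStrategy P ℱ T x X) : ∀ᵐ ω ∂P,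
      costV T f lam rho (optimalPath T x f lam rho nu) ≤ costV T f lam rho fun t => X t ω := by
  filter_upwards [hX.path] with ω hω using M.costV_optimalPath_le hnu hω

theorem costV_optimalPath_le_integral (M : MarketModel T f lam rho)
    (hnu : MultiplierEq T x f lam rho nu) {P : Measure Ω} [IsProbabilityMeasure P]
    {ℱ : Filtration ℝ≥0 mΩ} {X : ℝ → Ω → ℝ} (hX : AdmissibleStrategy P ℱ T x X) :
    costV T f lam rho (optimalPath T x f lam rho nu) ≤
      ∫ ω, costV T f lam rho (fun t => X t ω) ∂P := by
  have h := integral_mono_ae (integrable_const _) (M.integrable_costV hX)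
    (M.ae_costV_optimalPath_le hnu hX)
  simpa using h

/-- The pathwise inequality with equal integrals forces equality of costs almost surely, and
uniqueness among paths applies for each such `ω`. -/
theorem ae_eq_optimalPath_of_integral_eq (M : MarketModel T f lam rho)
    (hnu : MultiplierEq T x f lam rho nu) {P : Measure Ω} [IsProbabilityMeasure P]
    {ℱ : Filtration ℝ≥0 mΩ} {X : ℝ → Ω → ℝ} (hX : AdmissibleStrategy P ℱ T x X)
    (heq : ∫ ω, costV T f lam rho (fun t => X t ω) ∂P =
      costV T f lam rho (optimalPath T x f lam rho nu)) :
    ∀ᵐ ω ∂P, ∀ t, X t ω = optimalPath T x f lam rho nu t := by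
  have h := (integral_eq_iff_of_ae_le (integrable_const _) (M.integrable_costV hX)
    (M.ae_costV_optimalPath_le hnu hX)).1 (by simp [heq])
  filter_upwards [h, hX.path] with ω h1 h2 t
  exact congrFun (M.eq_optimalPath_of_costV_eq hnu h2 h1.symm) t

end MarketModel

end

end OptimalExecution

/-! ### The main theorem -/

open OptimalExecution in
theorem mainTheorem1
    (T : ℝ) (hT : 0 < T) (x : ℝ) (f lam rho : ℝ → ℝ)
    (hf : ContDiff ℝ 1 f) (hf_pos : ∀ y, 0 < f y)
    (hF_bot : Tendsto (shapeF f) atBot atBot) (hF_top : Tendsto (shapeF f) atTop atTop)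
    (hlam : ContDiffOn ℝ 2 lam (Icc 0 T)) (hlam_pos : ∀ t ∈ Icc 0 T, 0 < lam t)
    (hrho : ContDiffOn ℝ 1 rho (Icc 0 T)) (hrho_pos : ∀ t ∈ Icc 0 T, 0 < rho t)
    (hh_bij : ∀ t ∈ Icc 0 T, Function.Bijective (hV T f lam rho t))
    (hh_deriv : ∀ t ∈ Icc 0 T, ∀ y, 0 < deriv (hV T f lam rho t) y) :
    -- the cost is well defined (its integral and its sum converge) and nonnegative
    (∀ X, AdmissiblePath T x X →
      (pathMeasure X).IntegrableOn (priceImpact f lam rho X) (continuityTimes T X) ∧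
      (Summable fun t : Icc (0 : ℝ) T => jumpCost f lam rho X t) ∧
      0 ≤ costV T f lam rho X) ∧
    -- the equation for `ν` has a unique solution
    (∃! nu, MultiplierEq T x f lam rho nu) ∧
    ∀ nu, MultiplierEq T x f lam rho nu →
      -- `ζ` is continuously differentiable, so that the trading rate is meaningful and continuous
      ContDiffOn ℝ 1 (zeta T f lam rho nu) (Icc 0 T) ∧
      ContinuousOn (tradingRate T f lam rho nu) (Icc 0 T) ∧
      -- `X*` is admissible, is optimal, and is the only optimal strategy
      AdmissiblePath T x (optimalPath T x f lam rho nu) ∧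
      (∀ X, AdmissiblePath T x X →
        costV T f lam rho (optimalPath T x f lam rho nu) ≤ costV T f lam rho X ∧
        (costV T f lam rho X = costV T f lam rho (optimalPath T x f lam rho nu) →
          X = optimalPath T x f lam rho nu)) ∧
      -- the same among random strategies, for the expected cost
      (∀ {Ω : Type*} [mΩ : MeasurableSpace Ω] (P : Measure Ω) [IsProbabilityMeasure P]
        (ℱ : Filtration ℝ≥0 mΩ),
        AdmissibleStrategy P ℱ T x (fun t _ => optimalPath T x f lam rho nu t) ∧
        ∀ X : ℝ → Ω → ℝ, AdmissibleStrategy P ℱ T x X →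
        Integrable (fun ω => costV T f lam rho (fun t => X t ω)) P ∧
        costV T f lam rho (optimalPath T x f lam rho nu) ≤
          ∫ ω, costV T f lam rho (fun t => X t ω) ∂P ∧
        ((∫ ω, costV T f lam rho (fun t => X t ω) ∂P) =
            costV T f lam rho (optimalPath T x f lam rho nu) →
          ∀ᵐ ω ∂P, ∀ t, X t ω = optimalPath T x f lam rho nu t)) ∧
      -- the initial trade has the sign of `-x`
      SignType.sign (initialTrade T f lam rho nu) = SignType.sign (-x) := by
  have M : MarketModel T f lam rho := ⟨hT, hf, hf_pos, hF_bot, hF_top, hlam, hlam_pos, hrho,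
    hrho_pos, hh_bij, hh_deriv⟩
  refine ⟨fun X hX => ?_, M.existsUnique_multiplierEq x, fun nu hnu => ⟨M.contDiffOn_zeta nu,
    M.continuousOn_tradingRate nu, M.admissiblePath_optimalPath hnu,
    fun X hX => ⟨M.costV_optimalPath_le hnu hX, M.eq_optimalPath_of_costV_eq hnu hX⟩,
    fun P _ ℱ => ⟨M.admissibleStrategy_optimalPath hnu P ℱ, fun X hX => ⟨M.integrable_costV hX,
      M.costV_optimalPath_le_integral hnu hX, M.ae_eq_optimalPath_of_integral_eq hnu hX⟩⟩,
    M.sign_initialTrade hnu⟩⟩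
  obtain ⟨h1, h2, h3⟩ := M.costV_spec hX
  exact ⟨h1, h2, h3 ▸ M.reducedCost_nonneg x _⟩
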